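/- For $\kappa\in\mathbb C$ let $\mathrm{sn}(u)=\mathrm{sn}(u,\kappa)$ be the Jacobi elliptic sine of modulus $\kappa$, i.e. the unique meromorphic function on $\mathbb C$ with $\mathrm{sn}(0)=0$, $\mathrm{sn}'(0)=1$ and $(\mathrm{sn}')^2=(1-\mathrm{sn}^2)(1-\kappa^2\,\mathrm{sn}^2)$. Simplicial cochains have complex coefficients, and simplices are oriented by a fixed linear order of the vertices, so that $(\delta\nu)_{ijk}=\nu_{jk}-\nu_{ik}+\nu_{ij}$ for $i<j<k$. (a) Let $K$ be a simplicial complex (for example a triangulated manifold) with linearly ordered vertices and with a complex number $x_i$ attached to each vertex $i$, such that $x_i-x_j$ is not a pole of $\mathrm{sn}$ for any edge $ij$ of $K$. Then the 2-cochain $$\omega_{ijk}=\mathrm{sn}(x_i-x_j)\,\mathrm{sn}(x_i-x_k)\,\mathrm{sn}(x_j-x_k)\qquad(i<j<k)$$ is a coboundary: $\omega=\delta\nu$ for some 1-cochain $\nu$. (b) A generic 2-cocycle on the 4-simplex $12345$ can be represented in this form up to a common factor. That is, there is a nonempty Zariski open subset of the six-dimensional space of complex 2-cocycles on the 4-simplex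 such that for every $\omega$ in it there exist a modulus $\kappa\in\mathbb C\setminus\{0,1,-1\}$, numbers $x_1,\dots,x_5\in\mathbb C$ no difference $x_i-x_j$ of which is a pole of $\mathrm{sn}(\cdot,\kappa)$, and a constant $c\in\mathbb C\setminus\{0\}$ with $$\omega_{ijk}=c\,\mathrm{sn}(x_i-x_j,\kappa)\,\mathrm{sn}(x_i-x_k,\kappa)\,\mathrm{sn}(x_j-x_k,\kappa)\qquad\text{for all }1\le i<j<k\le5 .$$ -/

import Mathlib

open scoped Topology
open Filter

/-! ### The Jacobi elliptic sine -/

/-- `f` is the Jacobi elliptic sine `u ↦ sn (u, κ)` of modulus `κ ∈ ℂ`: the meromorphic function on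
the complex plane with `f 0 = 0`, `f' 0 = 1` and `(f')² = (1 - f²) (1 - κ² f²)`, that is, the
meromorphic inverse of the elliptic integral `∫₀ dt / √((1 - t²) (1 - κ² t²))`.
The normal form only fixes the values at the poles, which are set to `0`; off the poles the function
is analytic. -/
structure IsJacobiSn (κ : ℂ) (f : ℂ → ℂ) : Prop where
  meromorphicNFOn : MeromorphicNFOn f Set.univ
  map_zero : f 0 = 0
  hasDerivAt_zero : HasDerivAt f 1 0
  deriv_sq : ∀ u, AnalyticAt ℂ f u →
    deriv f u ^ 2 = (1 - f u ^ 2) * (1 - κ ^ 2 * f u ^ 2)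

/-- The defining conditions of `sn`, required only near the origin (used in the existence proof). -/
structure IsSnGerm (κ : ℂ) (f : ℂ → ℂ) : Prop where
  an : AnalyticAt ℂ f 0
  map_zero : f 0 = 0
  deriv_zero : deriv f 0 = 1
  ode : ∀ᶠ u in 𝓝 (0 : ℂ), deriv f u ^ 2 = (1 - f u ^ 2) * (1 - κ ^ 2 * f u ^ 2)

/-- A local primitive of the elliptic integrand. -/
theorem exists_ellipticIntegral (κ : ℂ) : ∃ F g : ℂ → ℂ, AnalyticAt ℂ F 0 ∧ F 0 = 0 ∧
    g 0 = 1 ∧ ContinuousAt g 0 ∧ (∀ᶠ t in 𝓝 (0 : ℂ), HasDerivAt F (g t) t) ∧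
    ∀ᶠ t in 𝓝 (0 : ℂ), g t ^ 2 * ((1 - t ^ 2) * (1 - κ ^ 2 * t ^ 2)) = 1 := by
  let q : ℂ → ℂ := fun t => (1 - t ^ 2) * (1 - κ ^ 2 * t ^ 2)
  have hq0 : q 0 ∈ Complex.slitPlane := by simp [q]
  have hqd : Differentiable ℂ q := by intro t; fun_prop
  let g : ℂ → ℂ := fun t => (q t) ^ (-(1 / 2) : ℂ)
  have hev : ∀ᶠ t in 𝓝 (0 : ℂ), q t ∈ Complex.slitPlane :=
    hqd.continuous.continuousAt.eventually (Complex.isOpen_slitPlane.mem_nhds hq0)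
  obtain ⟨r, hr, hball⟩ := Metric.eventually_nhds_iff_ball.1 hev
  have hgd : DifferentiableOn ℂ g (Metric.ball 0 r) := fun t ht =>
    ((hqd t).cpow (differentiableAt_const _) (hball t ht)).differentiableWithinAt
  obtain ⟨F, hF0, hF⟩ := (hgd.isExactOn_ball).with_val_at 0 0
  have hnhds : Metric.ball (0 : ℂ) r ∈ 𝓝 (0 : ℂ) := Metric.ball_mem_nhds _ hr
  refine ⟨F, g, ?_, hF0, by simp [g, q], ?_, ?_, ?_⟩
  · have : DifferentiableOn ℂ F (Metric.ball 0 r) :=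
      fun t ht => (hF t ht).differentiableAt.differentiableWithinAt
    exact this.analyticAt hnhds
  · exact (hgd.differentiableAt hnhds).continuousAt
  · filter_upwards [hnhds] with t ht using hF t ht
  · filter_upwards [hev] with t ht
    have h0 : q t ≠ 0 := Complex.slitPlane_ne_zero ht
    change g t ^ 2 * q t = 1
    have : g t ^ 2 = (q t)⁻¹ := by
      simp only [g]
      rw [← Complex.cpow_nat_mul]
      norm_num [Complex.cpow_neg_one]
    rw [this, inv_mul_cancel₀ h0]

theorem eventually_eq_one_of_sq {h : ℂ → ℂ} (hc : ContinuousAt h 0) (h0 : h 0 = 1)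
    (hs : ∀ᶠ u in 𝓝 (0 : ℂ), h u ^ 2 = 1) : ∀ᶠ u in 𝓝 (0 : ℂ), h u = 1 := by
  have hne : ∀ᶠ u in 𝓝 (0 : ℂ), h u ≠ -1 := by
    apply hc.eventually_ne
    rw [h0]; norm_num
  filter_upwards [hs, hne] with u h1 h2
  exact (by simpa using h1 : h u = 1 ∨ h u = -1).resolve_right h2

theorem exists_isSnGerm (κ : ℂ) : ∃ f, IsSnGerm κ f := by
  obtain ⟨F, g, hF, hF0, hg0, hgc, hFg, hgq⟩ := exists_ellipticIntegral κ
  have hd : HasDerivAt F 1 0 := hg0 ▸ hFg.self_of_nhds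
  have hne : deriv F 0 ≠ 0 := by rw [hd.deriv]; exact one_ne_zero
  have hs : HasStrictDerivAt F (deriv F 0) 0 := hF.hasStrictDerivAt
  let f := hs.localInverse F (deriv F 0) 0 hne
  have hfF : f 0 = 0 := by
    have := (hs.eventually_left_inverse hne).self_of_nhds
    rwa [hF0] at this
  have hfs : HasStrictDerivAt f (deriv F 0)⁻¹ 0 := by
    have := hs.to_localInverse hne
    rwa [hF0] at this
  have hinv : (deriv F 0)⁻¹ = 1 := by rw [hd.deriv, inv_one]
  rw [hinv] at hfs
  have hr : ∀ᶠ u in 𝓝 (0 : ℂ), F (f u) = u := by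
    have := hs.eventually_right_inverse hne
    rwa [hF0] at this
  have han : AnalyticAt ℂ f 0 := by
    have := hF.analyticAt_localInverse hne
    rwa [hF0] at this
  have hft : Filter.Tendsto f (𝓝 0) (𝓝 0) := by
    have := han.continuousAt.tendsto; rwa [hfF] at this
  refine ⟨f, han, hfF, hfs.hasDerivAt.deriv, ?_⟩
  filter_upwards [hr.eventually_nhds, hft.eventually hFg, hft.eventually hgq,
    han.eventually_analyticAt] with u a b c d
  have h1 := (b.comp u d.differentiableAt.hasDerivAt).congr_of_eventuallyEq
    (f₁ := id) (by filter_upwards [a] with v hv using hv.symm)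
  have h2 : g (f u) * deriv f u = 1 := h1.unique (hasDerivAt_id u)
  have h3 : g (f u) ≠ 0 := left_ne_zero_of_mul_eq_one h2
  apply mul_left_cancel₀ (pow_ne_zero 2 h3)
  rw [c, ← mul_pow, h2, one_pow]

theorem IsSnGerm.integral {κ : ℂ} {f : ℂ → ℂ} (hf : IsSnGerm κ f) {F g : ℂ → ℂ}
    (hF0 : F 0 = 0) (hg0 : g 0 = 1) (hgc : ContinuousAt g 0)
    (hFg : ∀ᶠ t in 𝓝 (0 : ℂ), HasDerivAt F (g t) t)
    (hgq : ∀ᶠ t in 𝓝 (0 : ℂ), g t ^ 2 * ((1 - t ^ 2) * (1 - κ ^ 2 * t ^ 2)) = 1) :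
    ∀ᶠ u in 𝓝 (0 : ℂ), F (f u) = u := by
  have hfc : Filter.Tendsto f (𝓝 0) (𝓝 0) := by
    have := hf.an.continuousAt.tendsto; rwa [hf.map_zero] at this
  have h1 : ∀ᶠ u in 𝓝 (0 : ℂ), g (f u) * deriv f u = 1 := by
    apply eventually_eq_one_of_sq
    · refine ContinuousAt.mul ?_ hf.an.deriv.continuousAt
      apply ContinuousAt.comp _ hf.an.continuousAt
      rwa [hf.map_zero]
    · simp [hf.map_zero, hg0, hf.deriv_zero]
    · filter_upwards [hfc.eventually hgq, hf.ode] with u h h'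
      rw [mul_pow, h', h]
  have h2 : ∀ᶠ u in 𝓝 (0 : ℂ), HasDerivAt (fun u => F (f u) - u) 0 u := by
    filter_upwards [h1, hfc.eventually hFg, hf.an.eventually_analyticAt] with u a b c
    have := (b.comp u c.differentiableAt.hasDerivAt).sub (hasDerivAt_id u)
    rw [a, sub_self] at this
    exact this
  obtain ⟨r, hr, hb⟩ := Metric.eventually_nhds_iff_ball.1 h2
  filter_upwards [Metric.ball_mem_nhds (0 : ℂ) hr] with u hu
  have := Metric.isOpen_ball.is_const_of_deriv_eq_zero (convex_ball (0 : ℂ) r).isPreconnected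
    (fun x hx => (hb x hx).differentiableAt.differentiableWithinAt)
    (fun x hx => (hb x hx).deriv) hu (Metric.mem_ball_self hr)
  simpa [hf.map_zero, hF0, sub_eq_zero] using this

theorem IsSnGerm.unique {κ : ℂ} {f₁ f₂ : ℂ → ℂ} (h₁ : IsSnGerm κ f₁) (h₂ : IsSnGerm κ f₂) :
    f₁ =ᶠ[𝓝 0] f₂ := by
  obtain ⟨F, g, hF, hF0, hg0, hgc, hFg, hgq⟩ := exists_ellipticIntegral κ
  have hd : HasDerivAt F 1 0 := hg0 ▸ hFg.self_of_nhds
  have hs : HasStrictDerivAt F 1 0 := hF.contDiffAt.hasStrictDerivAt' hd one_ne_zero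
  have hl := hs.eventually_left_inverse one_ne_zero
  have t₁ : Filter.Tendsto f₁ (𝓝 0) (𝓝 0) := by
    have := h₁.an.continuousAt.tendsto; rwa [h₁.map_zero] at this
  have t₂ : Filter.Tendsto f₂ (𝓝 0) (𝓝 0) := by
    have := h₂.an.continuousAt.tendsto; rwa [h₂.map_zero] at this
  filter_upwards [t₁.eventually hl, t₂.eventually hl, h₁.integral hF0 hg0 hgc hFg hgq,
    h₂.integral hF0 hg0 hgc hFg hgq] with u a b c d
  rw [← a, ← b, c, d]

/-- Candidate for `u ↦ f u` obtained from the duplication formula. -/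
noncomputable def snDouble (κ : ℂ) (f : ℂ → ℂ) (u : ℂ) : ℂ :=
  2 * f (u / 2) * deriv f (u / 2) / (1 - κ ^ 2 * f (u / 2) ^ 4)

theorem IsSnGerm.double {κ : ℂ} {f : ℂ → ℂ} (hf : IsSnGerm κ f) : IsSnGerm κ (snDouble κ f) := by
  have hhalf : Filter.Tendsto (fun u : ℂ => u / 2) (𝓝 0) (𝓝 0) := by
    have : ContinuousAt (fun u : ℂ => u / 2) 0 := by fun_prop
    simpa [ContinuousAt] using this
  have hft : Filter.Tendsto f (𝓝 0) (𝓝 0) := by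
    have := hf.an.continuousAt.tendsto; rwa [hf.map_zero] at this
  have hD : ∀ᶠ u in 𝓝 (0 : ℂ), 1 - κ ^ 2 * f u ^ 4 ≠ 0 := by
    have : ContinuousAt (fun u => 1 - κ ^ 2 * f u ^ 4) 0 := by
      have := hf.an.continuousAt
      fun_prop
    apply this.eventually_ne
    simp [hf.map_zero]
  have hd0 : ∀ᶠ u in 𝓝 (0 : ℂ), deriv f u ≠ 0 := by
    apply hf.an.deriv.continuousAt.eventually_ne
    simp [hf.deriv_zero]
  have hdd : ∀ᶠ u in 𝓝 (0 : ℂ), HasDerivAt (deriv f)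
      (-(1 + κ ^ 2) * f u + 2 * κ ^ 2 * f u ^ 3) u := by
    filter_upwards [hf.ode.eventually_nhds, hf.an.eventually_analyticAt, hd0] with u a b c
    have h1 := b.differentiableAt.hasDerivAt
    have h2 := b.deriv.differentiableAt.hasDerivAt
    have h3 := h2.pow 2
    have h4 := ((h1.pow 2).const_sub 1).mul (((h1.pow 2).const_mul (κ ^ 2)).const_sub 1)
    have h5 := (h4.congr_of_eventuallyEq (f₁ := deriv f ^ 2)
      (by filter_upwards [a] with v hv using hv)).unique h3
    have h6 : deriv (deriv f) u = -(1 + κ ^ 2) * f u + 2 * κ ^ 2 * f u ^ 3 := by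
      apply mul_left_cancel₀ (mul_ne_zero two_ne_zero c)
      simp only [Pi.pow_apply] at h5
      push_cast at h5
      linear_combination -h5
    rwa [h6] at h2
  have key : ∀ᶠ u in 𝓝 (0 : ℂ), AnalyticAt ℂ (snDouble κ f) u ∧
      deriv (snDouble κ f) u = (((1 - f (u / 2) ^ 2) * (1 - κ ^ 2 * f (u / 2) ^ 2)
        + f (u / 2) * (-(1 + κ ^ 2) * f (u / 2) + 2 * κ ^ 2 * f (u / 2) ^ 3))
          * (1 - κ ^ 2 * f (u / 2) ^ 4)
        + 4 * κ ^ 2 * f (u / 2) ^ 4 * ((1 - f (u / 2) ^ 2) * (1 - κ ^ 2 * f (u / 2) ^ 2)))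
        / (1 - κ ^ 2 * f (u / 2) ^ 4) ^ 2 ∧
      1 - κ ^ 2 * f (u / 2) ^ 4 ≠ 0 ∧
      deriv f (u / 2) ^ 2 = (1 - f (u / 2) ^ 2) * (1 - κ ^ 2 * f (u / 2) ^ 2) := by
    filter_upwards [hhalf.eventually hD, hhalf.eventually hdd, hhalf.eventually hf.ode,
      hhalf.eventually hf.an.eventually_analyticAt] with u a b c d
    have hh : HasDerivAt (fun u : ℂ => u / 2) (1 / 2) u := (hasDerivAt_id u).div_const 2
    have hA : AnalyticAt ℂ (fun u : ℂ => u / 2) u := by fun_prop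
    have d1 : AnalyticAt ℂ (fun u => f (u / 2)) u := d.comp_of_eq hA rfl
    have d2 : AnalyticAt ℂ (fun u => deriv f (u / 2)) u := d.deriv.comp_of_eq hA rfl
    have e1 : HasDerivAt (fun u => f (u / 2)) (deriv f (u / 2) * (1 / 2)) u :=
      d.differentiableAt.hasDerivAt.comp u hh
    have e2 : HasDerivAt (fun u => deriv f (u / 2))
        ((-(1 + κ ^ 2) * f (u / 2) + 2 * κ ^ 2 * f (u / 2) ^ 3) * (1 / 2)) u :=
      HasDerivAt.comp (h₂ := deriv f) (h := fun u : ℂ => u / 2) u b hh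
    refine ⟨((analyticAt_const.mul d1).mul d2).div
      (analyticAt_const.sub (analyticAt_const.mul (d1.pow 4))) a, ?_, a, c⟩
    have e3 := ((e1.const_mul 2).mul e2).div (((e1.pow 4).const_mul (κ ^ 2)).const_sub 1) a
    refine (HasDerivAt.deriv (f := snDouble κ f) e3).trans ?_
    rw [← c]
    simp only [Pi.pow_apply, Pi.mul_apply]
    congr 1
    push_cast
    ring
  obtain ⟨k1, k2, -, -⟩ := key.self_of_nhds
  refine ⟨k1, by simp [snDouble, hf.map_zero], by simpa [hf.map_zero] using k2, ?_⟩
  filter_upwards [key] with u ⟨_, h2, h3, h4⟩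
  have h5 : snDouble κ f u ^ 2 = 4 * f (u / 2) ^ 2 * ((1 - f (u / 2) ^ 2) *
      (1 - κ ^ 2 * f (u / 2) ^ 2)) / (1 - κ ^ 2 * f (u / 2) ^ 4) ^ 2 := by
    rw [snDouble, div_pow, mul_pow, h4]
    ring
  rw [h5, h2]
  generalize f (u / 2) = s at h3
  generalize hDs : 1 - κ ^ 2 * s ^ 4 = D at h3
  field_simp
  rw [← hDs]
  ring

theorem meromorphicOn_snDouble {κ : ℂ} {f : ℂ → ℂ} {R : ℝ}
    (hf : MeromorphicOn f (Metric.ball 0 R)) :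
    MeromorphicOn (snDouble κ f) (Metric.ball 0 (2 * R)) := by
  intro u hu
  have hu' : u / 2 ∈ Metric.ball (0 : ℂ) R := by
    simp only [mem_ball_zero_iff, norm_div, Complex.norm_ofNat] at hu ⊢
    linarith
  have hA : AnalyticAt ℂ (fun u : ℂ => u / 2) u := by fun_prop
  have h1 : MeromorphicAt (fun u => f (u / 2)) u :=
    MeromorphicAt.comp_analyticAt (g := fun u : ℂ => u / 2) (hf _ hu') hA
  have h2 : MeromorphicAt (fun u => deriv f (u / 2)) u :=
    MeromorphicAt.comp_analyticAt (g := fun u : ℂ => u / 2) (hf _ hu').deriv hA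
  exact (((MeromorphicAt.const 2 u).mul h1).mul h2).div
    ((MeromorphicAt.const 1 u).sub ((MeromorphicAt.const (κ ^ 2) u).mul (h1.pow 4)))

theorem IsSnGerm.extend {κ : ℂ} {f : ℂ → ℂ} (hf : IsSnGerm κ f) : ∃ r > 0, ∀ n : ℕ,
    ∃ g : ℂ → ℂ, MeromorphicOn g (Metric.ball 0 (2 ^ n * r)) ∧ IsSnGerm κ g := by
  obtain ⟨r, hr, hb⟩ := Metric.eventually_nhds_iff_ball.1 hf.an.eventually_analyticAt
  refine ⟨r, hr, fun n => ?_⟩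
  induction n with
  | zero => exact ⟨f, fun u hu => (hb u (by simpa using hu)).meromorphicAt, hf⟩
  | succ n ih =>
    obtain ⟨g, h1, h2⟩ := ih
    refine ⟨snDouble κ g, ?_, h2.double⟩
    rw [pow_succ', mul_assoc]
    exact meromorphicOn_snDouble h1

/-- Identity theorem on a disc about the origin. -/
theorem meromorphic_identity {f g : ℂ → ℂ} {R : ℝ} (hR : 0 < R)
    (hf : MeromorphicOn f (Metric.ball 0 R)) (hg : MeromorphicOn g (Metric.ball 0 R))
    (h : f =ᶠ[𝓝 0] g) {u : ℂ} (hu : u ∈ Metric.ball 0 R) : f =ᶠ[𝓝[≠] u] g := by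
  have h0 : meromorphicOrderAt (f - g) 0 = ⊤ := by
    rw [meromorphicOrderAt_eq_top_iff]
    filter_upwards [h.filter_mono nhdsWithin_le_nhds] with v hv
    simp [hv]
  have h1 : meromorphicOrderAt (f - g) u = ⊤ := by
    by_contra hne
    exact (hf.sub hg).meromorphicOrderAt_ne_top_of_isPreconnected
      (convex_ball (0 : ℂ) R).isPreconnected hu (Metric.mem_ball_self hR) hne h0
  rw [meromorphicOrderAt_eq_top_iff] at h1
  filter_upwards [h1] with v hv
  simpa [sub_eq_zero] using hv

theorem exists_isJacobiSn (κ : ℂ) : ∃ f : ℂ → ℂ, IsJacobiSn κ f := by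
  obtain ⟨f₀, hf₀⟩ := exists_isSnGerm κ
  obtain ⟨r, hr, hext⟩ := hf₀.extend
  choose g hg hgs using hext
  let R : ℕ → ℝ := fun n => 2 ^ n * r
  have hR : ∀ n, 0 < R n := fun n => by positivity
  let G : ℕ → ℂ → ℂ := fun n => toMeromorphicNFOn (g n) (Metric.ball 0 (R n))
  have hG : ∀ n, MeromorphicNFOn (G n) (Metric.ball 0 (R n)) :=
    fun n => meromorphicNFOn_toMeromorphicNFOn _ _
  have hGg : ∀ n, ∀ u ∈ Metric.ball (0 : ℂ) (R n), G n =ᶠ[𝓝[≠] u] g n :=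
    fun n u hu => (hg n).toMeromorphicNFOn_eq_self_on_nhdsNE hu
  have hmono : ∀ m n, m ≤ n → Metric.ball (0 : ℂ) (R m) ⊆ Metric.ball 0 (R n) := by
    intro m n hmn
    apply Metric.ball_subset_ball
    exact mul_le_mul_of_nonneg_right (pow_le_pow_right₀ one_le_two hmn) hr.le
  have hagree : ∀ m n, m ≤ n → ∀ u ∈ Metric.ball (0 : ℂ) (R m), G m =ᶠ[𝓝 u] G n := by
    intro m n hmn u hu
    rw [← (hG m hu).eventuallyEq_nhdsNE_iff_eventuallyEq_nhds (hG n (hmono m n hmn hu))]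
    refine (hGg m u hu).trans (EventuallyEq.trans ?_ (hGg n u (hmono m n hmn hu)).symm)
    exact meromorphic_identity (hR m) (hg m) ((hg n).mono_set (hmono m n hmn))
      ((hgs m).unique (hgs n)) hu
  have hcov : ∀ u : ℂ, ∃ n, u ∈ Metric.ball (0 : ℂ) (R n) := by
    intro u
    obtain ⟨n, hn⟩ := pow_unbounded_of_one_lt (‖u‖ / r) (one_lt_two)
    exact ⟨n, by simpa [R] using (div_lt_iff₀ hr).1 hn⟩
  choose N hN using hcov
  let f : ℂ → ℂ := fun u => G (N u) u
  have hf : ∀ n, ∀ u ∈ Metric.ball (0 : ℂ) (R n), f =ᶠ[𝓝 u] G n := by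
    intro n u hu
    filter_upwards [Metric.isOpen_ball.mem_nhds hu] with v hv
    rcases le_total (N v) n with h | h
    · exact (hagree _ _ h v (hN v)).eq_of_nhds
    · exact (hagree _ _ h v hv).eq_of_nhds.symm
  have hfNF : MeromorphicNFOn f Set.univ := by
    intro u _
    rw [meromorphicNFAt_congr (hf _ u (hN u))]
    exact hG _ (hN u)
  have hfg : f =ᶠ[𝓝 0] g 0 := by
    have h0 : (0 : ℂ) ∈ Metric.ball (0 : ℂ) (R 0) := Metric.mem_ball_self (hR 0)
    refine (hf 0 0 h0).trans ?_
    rw [← (hG 0 h0).eventuallyEq_nhdsNE_iff_eventuallyEq_nhds (hgs 0).an.meromorphicNFAt]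
    exact hGg 0 0 h0
  have hf0 : AnalyticAt ℂ f 0 := (hgs 0).an.congr hfg.symm
  refine ⟨f, hfNF, hfg.eq_of_nhds.trans (hgs 0).map_zero, ?_, ?_⟩
  · have := hf0.differentiableAt.hasDerivAt
    rwa [hfg.deriv_eq, (hgs 0).deriv_zero] at this
  · intro u hu
    have hm : MeromorphicOn f (Metric.ball 0 (‖u‖ + 1)) := fun v _ =>
      (hfNF (Set.mem_univ v)).meromorphicAt
    have hode : (fun v => deriv f v ^ 2) =ᶠ[𝓝 0]
        fun v => (1 - f v ^ 2) * (1 - κ ^ 2 * f v ^ 2) := by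
      filter_upwards [(hgs 0).ode, hfg, hfg.deriv] with v a b c
      rw [b, c, a]
    have hcont : ContinuousAt (fun v => (1 - f v ^ 2) * (1 - κ ^ 2 * f v ^ 2)) u := by
      have := hu.continuousAt
      fun_prop
    have hcont' : ContinuousAt (fun v => deriv f v ^ 2) u := hu.deriv.continuousAt.pow 2
    refine ((hcont'.eventuallyEq_nhds_iff_eventuallyEq_nhdsNE hcont).1
      (meromorphic_identity (R := ‖u‖ + 1) (by positivity) (fun v hv => (hm v hv).deriv.pow 2)
      (fun v hv => ?_) hode (by simp))).eq_of_nhds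
    exact ((MeromorphicAt.const 1 v).sub ((hm v hv).pow 2)).mul ((MeromorphicAt.const 1 v).sub
      ((MeromorphicAt.const (κ ^ 2) v).mul ((hm v hv).pow 2)))

/-- The Jacobi elliptic sine is unique. -/
theorem IsJacobiSn.unique {κ : ℂ} {f g : ℂ → ℂ} (hf : IsJacobiSn κ f) (hg : IsJacobiSn κ g) :
    f = g := by
  have germ : ∀ {f : ℂ → ℂ}, IsJacobiSn κ f → IsSnGerm κ f := by
    intro f hf
    have han : AnalyticAt ℂ f 0 := by
      rcases meromorphicNFAt_iff_analyticAt_or.1 (hf.meromorphicNFOn (Set.mem_univ 0)) with h | h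
      · exact h
      · exact h.1.analyticAt hf.hasDerivAt_zero.continuousAt
    exact ⟨han, hf.map_zero, hf.hasDerivAt_zero.deriv,
      han.eventually_analyticAt.mono fun u hu => hf.deriv_sq u hu⟩
  funext u
  have h1 := hf.meromorphicNFOn (Set.mem_univ u)
  have h2 := hg.meromorphicNFOn (Set.mem_univ u)
  refine ((h1.eventuallyEq_nhdsNE_iff_eventuallyEq_nhds h2).1 (meromorphic_identity
    (R := ‖u‖ + 1) (by positivity)
    (fun v _ => (hf.meromorphicNFOn (Set.mem_univ v)).meromorphicAt)
    (fun v _ => (hg.meromorphicNFOn (Set.mem_univ v)).meromorphicAt)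
    ((germ hf).unique (germ hg)) (by simp))).eq_of_nhds

/-- The Jacobi elliptic sine `sn (u, κ)` with modulus `κ`. A point `u` is a pole of it exactly when
it is not analytic there. -/
noncomputable def jacobiSn (κ : ℂ) : ℂ → ℂ := Classical.choose (exists_isJacobiSn κ)

theorem isJacobiSn_jacobiSn (κ : ℂ) : IsJacobiSn κ (jacobiSn κ) :=
  Classical.choose_spec (exists_isJacobiSn κ)

/-! ### Simplicial cochains -/

/-- The `n`-simplices of a simplicial complex with ordered vertices: the increasing sequences
`v₀ < ⋯ < vₙ` of vertices that span a face. -/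
def OrderedSimplex {V : Type*} [LinearOrder V] (K : AbstractSimplicialComplex V) (n : ℕ) : Type _ :=
  {s : Fin (n + 1) ↪o V // Finset.univ.map s.toEmbedding ∈ K.faces}

/-- The face of a simplex opposite to its `i`-th vertex. -/
def OrderedSimplex.face {V : Type*} [LinearOrder V] {K : AbstractSimplicialComplex V} {n : ℕ}
    (s : OrderedSimplex K (n + 1)) (i : Fin (n + 2)) : OrderedSimplex K n :=
  ⟨(Fin.succAboveOrderEmb i).trans s.1, by
    refine (K.isRelLowerSet_faces s.2).2 ?_ (by simp)
    intro v hv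
    simp only [Finset.mem_map, Finset.mem_univ, true_and] at hv ⊢
    obtain ⟨j, rfl⟩ := hv
    exact ⟨i.succAbove j, rfl⟩⟩

/-- Complex-valued simplicial `n`-cochains. -/
abbrev SimplicialCochain {V : Type*} [LinearOrder V] (K : AbstractSimplicialComplex V) (n : ℕ) :
    Type _ :=
  OrderedSimplex K n → ℂ

/-- The coboundary operator, `(δ ν) (v₀ … vₙ₊₁) = ∑ i, (-1)ⁱ ν (v₀ … v̂ᵢ … vₙ₊₁)`. -/
def simplicialCoboundary {V : Type*} [LinearOrder V] (K : AbstractSimplicialComplex V) (n : ℕ) :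
    SimplicialCochain K n →ₗ[ℂ] SimplicialCochain K (n + 1) where
  toFun ν := fun s => ∑ i : Fin (n + 2), (-1 : ℂ) ^ (i : ℕ) * ν (s.face i)
  map_add' ν ν' := by
    funext s
    simp only [Pi.add_apply, mul_add, Finset.sum_add_distrib]
  map_smul' c ν := by
    funext s
    simp only [Pi.smul_apply, smul_eq_mul, RingHom.id_apply, Finset.mul_sum]
    exact Finset.sum_congr rfl fun i _ => by ring

/-- The 4-simplex with all its faces; its vertices `0, …, 4` are the vertices `1, …, 5` of `12345`. -/
def fourSimplex : AbstractSimplicialComplex (Fin 5) where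
  faces := {s | s.Nonempty}
  isRelLowerSet_faces := fun _ hs => ⟨hs, fun _ _ ht => ht⟩
  singleton_mem v := Finset.singleton_nonempty v

/-- The 2-cochain `ω_{ijk} = sn (xᵢ - xⱼ) sn (xᵢ - xₖ) sn (xⱼ - xₖ)`, `i < j < k`. -/
noncomputable def ellipticCochain {V : Type*} [LinearOrder V] (K : AbstractSimplicialComplex V)
    (κ : ℂ) (x : V → ℂ) : SimplicialCochain K 2 := fun s =>
  jacobiSn κ (x (s.1 0) - x (s.1 1)) * jacobiSn κ (x (s.1 0) - x (s.1 2)) *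
    jacobiSn κ (x (s.1 1) - x (s.1 2))

/-- A property holds for a generic element of the space `W` if it holds on a nonempty Zariski open
subset of `W`: for all elements of `W` at which a certain polynomial in the coordinates, not
vanishing identically on `W`, is nonzero. -/
def HoldsGenerically {ι : Type*} (W : Submodule ℂ (ι → ℂ)) (P : (ι → ℂ) → Prop) : Prop :=
  ∃ p : MvPolynomial ι ℂ, (∃ w ∈ W, MvPolynomial.eval w p ≠ 0) ∧
    ∀ w ∈ W, MvPolynomial.eval w p ≠ 0 → P w

/-!
For the first part, `sn` satisfies an addition formula for a primitive: a function `h` with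
`h' = -sn²`, `h 0 = 0` has `h u + h v - h (u + v) = sn u sn v sn (u + v)`, so that
`ν i j = h (x i - x j)` has coboundary the elliptic cochain. The local primitive extends to a
meromorphic function on the plane by the duplication formula (`exists_primitive_neg_jacobiSn_sq`).
The formula itself follows from the addition theorem for `sn` (`jacobiSn_add`) by differentiation in
`u` and the identity theorem, and it shows that `h` is regular wherever `sn` is
(`exists_add_formula`).

For the second part, a 2-cocycle is given by its values `n i j` on the six triangles `i j 4`,
`i < j < 4`. Put the last vertex at the origin. It is convenient to absorb the factor `c` by a
rescaling and to work on the curve `y² = 1 + A x² + B x⁴`; the unknowns are `A`, `B`, the squares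
`S i` of the `x`-coordinates of four points and the quotients `γ i = y i / x i`. The triangles that
avoid the last vertex prescribe the products `S i * S j * S k`, which determines the `S i` up to a
common cube root `P`. The addition theorem then forces `B` and the `γ i`, and the equations for
different pairs `i, j` are compatible: `B` is `P` times the Pfaffian of `n` over the product of the
`n i j`, and the `γ i` are `P` times cubic polynomials in `n` over the same product
(`exists_curve_and_points`). All conditions of nondegeneracy become polynomial in `n`, since `P`
enters them through `P³` only (`genericityPoly`).

To realize the points by arguments of `sn` one needs that `sn` takes every value that is not a branch
value (`exists_jacobiSn_eq`). No periods are used for this: the set of these values is open, and the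
addition theorem shows that it is closed in the connected complement of the branch values. Since only
the square of `sn` and its logarithmic derivative are prescribed, the sign of `sn'` is adjusted by
`u ↦ -u` (`exists_jacobiSn_sq_eq`).
-/

/-! ### Meromorphic functions in normal form on the plane -/

theorem eventuallyEq_nhdsNE_of_eventuallyEq_nhds_zero {f g : ℂ → ℂ} (hf : ∀ z, MeromorphicAt f z)
    (hg : ∀ z, MeromorphicAt g z) (h : f =ᶠ[𝓝 0] g) (u : ℂ) : f =ᶠ[𝓝[≠] u] g :=
  meromorphic_identity (R := ‖u‖ + 1) (by positivity) (fun z _ => hf z) (fun z _ => hg z) h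
    (by simp)

theorem eq_of_eventuallyEq_nhds_zero {f g : ℂ → ℂ} (hf : ∀ z, MeromorphicAt f z)
    (hg : ∀ z, MeromorphicAt g z) (h : f =ᶠ[𝓝 0] g) {u : ℂ} (hfu : ContinuousAt f u)
    (hgu : ContinuousAt g u) : f u = g u :=
  ((hfu.eventuallyEq_nhds_iff_eventuallyEq_nhdsNE hgu).1
    (eventuallyEq_nhdsNE_of_eventuallyEq_nhds_zero hf hg h u)).eq_of_nhds

theorem MeromorphicNFAt.analyticAt_of_eventuallyEq_nhdsNE {f g : ℂ → ℂ} {u : ℂ}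
    (hf : MeromorphicNFAt f u) (hg : AnalyticAt ℂ g u) (h : f =ᶠ[𝓝[≠] u] g) :
    AnalyticAt ℂ f u ∧ f u = g u := by
  have := (hf.eventuallyEq_nhdsNE_iff_eventuallyEq_nhds hg.meromorphicNFAt).1 h
  exact ⟨hg.congr this.symm, this.eq_of_nhds⟩

theorem eventually_eq_of_deriv_eq_zero {f : ℂ → ℂ} {z : ℂ}
    (h : ∀ᶠ t in 𝓝 z, HasDerivAt f 0 t) : ∀ᶠ t in 𝓝 z, f t = f z := by
  obtain ⟨r, hr, hb⟩ := Metric.eventually_nhds_iff_ball.1 h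
  filter_upwards [Metric.ball_mem_nhds z hr] with t ht
  exact Metric.isOpen_ball.is_const_of_deriv_eq_zero (convex_ball z r).isPreconnected
    (fun x hx => (hb x hx).differentiableAt.differentiableWithinAt)
    (fun x hx => (hb x hx).deriv) ht (Metric.mem_ball_self hr)

/-! ### The addition theorem for the elliptic sine -/

section JacobiSn

variable (κ : ℂ)

theorem meromorphicNFAt_jacobiSn (z : ℂ) : MeromorphicNFAt (jacobiSn κ) z :=
  (isJacobiSn_jacobiSn κ).meromorphicNFOn (Set.mem_univ z)

theorem meromorphicAt_jacobiSn (z : ℂ) : MeromorphicAt (jacobiSn κ) z :=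
  (meromorphicNFAt_jacobiSn κ z).meromorphicAt

theorem jacobiSn_zero : jacobiSn κ 0 = 0 := (isJacobiSn_jacobiSn κ).map_zero

theorem deriv_jacobiSn_zero : deriv (jacobiSn κ) 0 = 1 :=
  (isJacobiSn_jacobiSn κ).hasDerivAt_zero.deriv

theorem analyticAt_jacobiSn_zero : AnalyticAt ℂ (jacobiSn κ) 0 :=
  (meromorphicAt_jacobiSn κ 0).analyticAt (isJacobiSn_jacobiSn κ).hasDerivAt_zero.continuousAt

variable {κ}

theorem deriv_jacobiSn_sq {u : ℂ} (hu : AnalyticAt ℂ (jacobiSn κ) u) :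
    deriv (jacobiSn κ) u ^ 2 = (1 - jacobiSn κ u ^ 2) * (1 - κ ^ 2 * jacobiSn κ u ^ 2) :=
  (isJacobiSn_jacobiSn κ).deriv_sq u hu

variable (κ) in
theorem jacobiSn_neg (u : ℂ) : jacobiSn κ (-u) = -jacobiSn κ u := by
  have key : IsJacobiSn κ (fun u => -jacobiSn κ (-u)) := by
    refine ⟨fun z _ => ?_, by simp [jacobiSn_zero], ?_, fun u hu => ?_⟩
    · have h1 : MeromorphicNFAt (jacobiSn κ ∘ fun u => -u) z :=
        (meromorphicNFAt_jacobiSn κ (-z)).comp_analyticAt (by fun_prop)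
      have h2 := (meromorphicNFAt_smul_iff_right_of_analyticAt
        (analyticAt_const (v := (-1 : ℂ)) (x := z)) (by simp)).2 h1
      refine (meromorphicNFAt_congr (Eventually.of_forall fun u => ?_)).1 h2
      simp
    · have h0 : HasDerivAt (jacobiSn κ) 1 (-0 : ℂ) := by
        rw [neg_zero]; exact (isJacobiSn_jacobiSn κ).hasDerivAt_zero
      exact HasDerivAt.congr_deriv (f := fun u => -jacobiSn κ (-u))
        (h0.comp (0 : ℂ) (hasDerivAt_neg (0 : ℂ))).neg (by simp)
    · have h1 : AnalyticAt ℂ (jacobiSn κ) (-u) := by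
        have h2 : AnalyticAt ℂ (fun v => -(-jacobiSn κ (-(-v)))) (-u) :=
          (AnalyticAt.comp_of_eq (f := fun v : ℂ => -v) hu (by fun_prop) (neg_neg u)).neg
        simpa using h2
      have h3 : deriv (fun u => -jacobiSn κ (-u)) u = deriv (jacobiSn κ) (-u) := by
        rw [deriv.fun_neg, deriv_comp_neg, neg_neg]
      rw [h3, neg_sq]
      exact deriv_jacobiSn_sq h1
  have := congrFun ((isJacobiSn_jacobiSn κ).unique key) u
  rw [this, neg_neg]

theorem analyticAt_jacobiSn_neg {u : ℂ} (hu : AnalyticAt ℂ (jacobiSn κ) u) :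
    AnalyticAt ℂ (jacobiSn κ) (-u) := by
  have h2 : AnalyticAt ℂ (fun v => -jacobiSn κ (-v)) (-u) :=
    (AnalyticAt.comp_of_eq (f := fun v : ℂ => -v) hu (by fun_prop) (neg_neg u)).neg
  simpa [jacobiSn_neg] using h2

variable (κ) in
theorem deriv_jacobiSn_neg (u : ℂ) : deriv (jacobiSn κ) (-u) = deriv (jacobiSn κ) u := by
  have h1 : jacobiSn κ = fun u => -jacobiSn κ (-u) := by
    funext u; rw [jacobiSn_neg, neg_neg]
  conv_rhs => rw [h1]
  rw [deriv.fun_neg, deriv_comp_neg, neg_neg]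

/-- The second-order equation, got by differentiating the first-order one near the origin, where
`sn' ≠ 0`, and continuing. -/
theorem deriv_deriv_jacobiSn {u : ℂ} (hu : AnalyticAt ℂ (jacobiSn κ) u) :
    deriv (deriv (jacobiSn κ)) u =
      -(1 + κ ^ 2) * jacobiSn κ u + 2 * κ ^ 2 * jacobiSn κ u ^ 3 := by
  have hm := meromorphicAt_jacobiSn κ
  refine eq_of_eventuallyEq_nhds_zero (f := deriv (deriv (jacobiSn κ)))
    (g := fun u => -(1 + κ ^ 2) * jacobiSn κ u + 2 * κ ^ 2 * jacobiSn κ u ^ 3)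
    (fun z => (hm z).deriv.deriv) (fun z => ((MeromorphicAt.const _ z).mul (hm z)).add
      ((MeromorphicAt.const _ z).mul ((hm z).pow 3))) ?_ hu.deriv.deriv.continuousAt
    ((continuousAt_const.mul hu.continuousAt).add
      (continuousAt_const.mul (hu.continuousAt.pow 3)))
  have h0 := analyticAt_jacobiSn_zero κ
  have hne : ∀ᶠ u in 𝓝 (0 : ℂ), deriv (jacobiSn κ) u ≠ 0 := by
    apply h0.deriv.continuousAt.eventually_ne
    simp [deriv_jacobiSn_zero]
  filter_upwards [h0.eventually_analyticAt.eventually_nhds, hne] with u b c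
  have h1 := b.self_of_nhds.differentiableAt.hasDerivAt
  have h3 := b.self_of_nhds.deriv.differentiableAt.hasDerivAt.pow 2
  have h4 := ((h1.pow 2).const_sub 1).mul (((h1.pow 2).const_mul (κ ^ 2)).const_sub 1)
  have h5 := (h4.congr_of_eventuallyEq (f₁ := deriv (jacobiSn κ) ^ 2)
    (by filter_upwards [b] with v hv using deriv_jacobiSn_sq hv)).unique h3
  apply mul_left_cancel₀ (mul_ne_zero two_ne_zero c)
  simp only [Pi.pow_apply] at h5
  push_cast at h5
  linear_combination -h5

/-- For a fixed regular point `c`, the addition formula at `t` and `c - t` has derivative `0` in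
`t`, so it is constant near `t = 0`, and keeps the value `sn c` by the identity theorem. -/
theorem jacobiSn_add_of_analyticAt {u v : ℂ} (hu : AnalyticAt ℂ (jacobiSn κ) u)
    (hv : AnalyticAt ℂ (jacobiSn κ) v) (huv : AnalyticAt ℂ (jacobiSn κ) (u + v)) :
    jacobiSn κ (u + v) * (1 - κ ^ 2 * jacobiSn κ u ^ 2 * jacobiSn κ v ^ 2) =
      jacobiSn κ u * deriv (jacobiSn κ) v + jacobiSn κ v * deriv (jacobiSn κ) u := by
  obtain ⟨c, hc⟩ : ∃ c, c = u + v := ⟨_, rfl⟩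
  obtain rfl : v = c - u := by rw [hc]; ring
  rw [← hc] at huv ⊢
  have hm := meromorphicAt_jacobiSn κ
  have hA : ∀ z, AnalyticAt ℂ (fun t : ℂ => c - t) z := fun z => by fun_prop
  have hm2 : ∀ z, MeromorphicAt (fun t => jacobiSn κ (c - t)) z := fun z =>
    MeromorphicAt.comp_analyticAt (g := fun t : ℂ => c - t) (hm _) (hA z)
  have hm3 : ∀ z, MeromorphicAt (fun t => deriv (jacobiSn κ) (c - t)) z := fun z =>
    MeromorphicAt.comp_analyticAt (g := fun t : ℂ => c - t) (hm _).deriv (hA z)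
  have ha2 : ∀ z, AnalyticAt ℂ (jacobiSn κ) (c - z) →
      AnalyticAt ℂ (fun t => jacobiSn κ (c - t)) z := fun z h => h.comp_of_eq (hA z) rfl
  have ha3 : ∀ z, AnalyticAt ℂ (jacobiSn κ) (c - z) →
      AnalyticAt ℂ (fun t => deriv (jacobiSn κ) (c - t)) z := fun z h =>
    h.deriv.comp_of_eq (hA z) rfl
  let N : ℂ → ℂ := fun t => jacobiSn κ t * deriv (jacobiSn κ) (c - t) +
    jacobiSn κ (c - t) * deriv (jacobiSn κ) t
  let D : ℂ → ℂ := fun t => 1 - κ ^ 2 * jacobiSn κ t ^ 2 * jacobiSn κ (c - t) ^ 2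
  have hN : ∀ t, AnalyticAt ℂ (jacobiSn κ) t → AnalyticAt ℂ (jacobiSn κ) (c - t) →
      AnalyticAt ℂ N t := fun t h h' => (h.mul (ha3 t h')).add ((ha2 t h').mul h.deriv)
  have hD : ∀ t, AnalyticAt ℂ (jacobiSn κ) t → AnalyticAt ℂ (jacobiSn κ) (c - t) →
      AnalyticAt ℂ D t := fun t h h' =>
    analyticAt_const.sub ((analyticAt_const.mul (h.pow 2)).mul ((ha2 t h').pow 2))
  refine (eq_of_eventuallyEq_nhds_zero (f := fun t => jacobiSn κ c * D t) (g := N)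
    (fun z => (MeromorphicAt.const _ z).mul ((MeromorphicAt.const _ z).sub
      (((MeromorphicAt.const _ z).mul ((hm z).pow 2)).mul ((hm2 z).pow 2))))
    (fun z => ((hm z).mul (hm3 z)).add ((hm2 z).mul (hm z).deriv)) ?_
    (continuousAt_const.mul (hD u hu hv).continuousAt) (hN u hu hv).continuousAt)
  have h0 := analyticAt_jacobiSn_zero κ
  have hc0 : Tendsto (fun t : ℂ => c - t) (𝓝 0) (𝓝 c) := by
    have : ContinuousAt (fun t : ℂ => c - t) 0 := by fun_prop
    simpa [ContinuousAt] using this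
  have hD0 : ∀ᶠ t in 𝓝 (0 : ℂ), D t ≠ 0 := by
    apply (hD 0 h0 (by simpa using huv)).continuousAt.eventually_ne
    simp [D, jacobiSn_zero]
  have hder : ∀ᶠ t in 𝓝 (0 : ℂ), HasDerivAt (fun t => N t / D t) 0 t := by
    filter_upwards [h0.eventually_analyticAt, hc0.eventually huv.eventually_analyticAt, hD0]
      with t a b d
    have hh : HasDerivAt (fun t : ℂ => c - t) (-1) t := (hasDerivAt_id t).const_sub c
    have e1 := a.differentiableAt.hasDerivAt
    have e1' := a.deriv.differentiableAt.hasDerivAt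
    have e2 : HasDerivAt (fun t => jacobiSn κ (c - t)) (deriv (jacobiSn κ) (c - t) * -1) t :=
      b.differentiableAt.hasDerivAt.comp t hh
    have e2' : HasDerivAt (fun t => deriv (jacobiSn κ) (c - t))
        (deriv (deriv (jacobiSn κ)) (c - t) * -1) t :=
      HasDerivAt.comp (h₂ := deriv (jacobiSn κ)) (h := fun t : ℂ => c - t) t
        b.deriv.differentiableAt.hasDerivAt hh
    have e3 := ((e1.mul e2').add (e2.mul e1')).div
      (((((e1.pow 2).const_mul (κ ^ 2)).mul (e2.pow 2))).const_sub 1) d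
    refine HasDerivAt.congr_deriv (f := fun t => N t / D t) e3 ?_
    rw [div_eq_zero_iff]
    left
    rw [deriv_deriv_jacobiSn a, deriv_deriv_jacobiSn b]
    have q1 := deriv_jacobiSn_sq a
    have q2 := deriv_jacobiSn_sq b
    simp only [Pi.pow_apply, Pi.mul_apply, Pi.add_apply]
    push_cast
    generalize jacobiSn κ t = s1 at *
    generalize jacobiSn κ (c - t) = s2 at *
    generalize deriv (jacobiSn κ) t = d1 at *
    generalize deriv (jacobiSn κ) (c - t) = d2 at *
    linear_combination (2 * κ ^ 2 * s1 * s2) * (s2 ^ 2 * q1 - s1 ^ 2 * q2)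
  filter_upwards [eventually_eq_of_deriv_eq_zero hder, hD0] with t h hd
  have : N 0 / D 0 = jacobiSn κ c := by simp [N, D, jacobiSn_zero, deriv_jacobiSn_zero]
  rw [this, div_eq_iff hd] at h
  exact h.symm

/-- The addition theorem, including that `u + v` is not a pole when the denominator is nonzero. -/
theorem jacobiSn_add {u v : ℂ} (hu : AnalyticAt ℂ (jacobiSn κ) u)
    (hv : AnalyticAt ℂ (jacobiSn κ) v)
    (hD : 1 - κ ^ 2 * jacobiSn κ u ^ 2 * jacobiSn κ v ^ 2 ≠ 0) :
    AnalyticAt ℂ (jacobiSn κ) (u + v) ∧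
    jacobiSn κ (u + v) * (1 - κ ^ 2 * jacobiSn κ u ^ 2 * jacobiSn κ v ^ 2) =
      jacobiSn κ u * deriv (jacobiSn κ) v + jacobiSn κ v * deriv (jacobiSn κ) u := by
  suffices h : AnalyticAt ℂ (jacobiSn κ) (u + v) from ⟨h, jacobiSn_add_of_analyticAt hu hv h⟩
  let g : ℂ → ℂ := fun t => (jacobiSn κ t * deriv (jacobiSn κ) v +
    jacobiSn κ v * deriv (jacobiSn κ) t) / (1 - κ ^ 2 * jacobiSn κ t ^ 2 * jacobiSn κ v ^ 2)
  have hDa : AnalyticAt ℂ (fun t => 1 - κ ^ 2 * jacobiSn κ t ^ 2 * jacobiSn κ v ^ 2) u :=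
    analyticAt_const.sub ((analyticAt_const.mul (hu.pow 2)).mul analyticAt_const)
  have hg : AnalyticAt ℂ g u :=
    ((hu.mul analyticAt_const).add (analyticAt_const.mul hu.deriv)).div hDa hD
  have hnf : MeromorphicNFAt (fun t => jacobiSn κ (t + v)) u :=
    (meromorphicNFAt_jacobiSn κ (u + v)).comp_analyticAt (g := fun t => t + v) (by fun_prop)
  have hlim : Tendsto (fun t : ℂ => t + v) (𝓝[≠] u) (𝓝[≠] (u + v)) := by
    refine tendsto_nhdsWithin_of_tendsto_nhds_of_eventually_within _
      ((by fun_prop : ContinuousAt (fun t : ℂ => t + v) u).tendsto.mono_left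
        nhdsWithin_le_nhds) ?_
    filter_upwards [self_mem_nhdsWithin] with t ht
    simpa using ht
  have heq : (fun t => jacobiSn κ (t + v)) =ᶠ[𝓝[≠] u] g := by
    filter_upwards [hu.eventually_analyticAt.filter_mono nhdsWithin_le_nhds,
      (hDa.continuousAt.eventually_ne hD).filter_mono nhdsWithin_le_nhds,
      hlim.eventually (meromorphicAt_jacobiSn κ (u + v)).eventually_analyticAt] with t a b c
    exact (eq_div_iff b).2 (jacobiSn_add_of_analyticAt a hv c)
  have := (hnf.analyticAt_of_eventuallyEq_nhdsNE hg heq).1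
  have h2 : AnalyticAt ℂ (fun t => jacobiSn κ (t - v + v)) (u + v) :=
    AnalyticAt.comp_of_eq (f := fun t => t - v) this (by fun_prop) (by ring)
  simpa using h2

theorem jacobiSn_sub {u v : ℂ} (hu : AnalyticAt ℂ (jacobiSn κ) u)
    (hv : AnalyticAt ℂ (jacobiSn κ) v)
    (hD : 1 - κ ^ 2 * jacobiSn κ u ^ 2 * jacobiSn κ v ^ 2 ≠ 0) :
    AnalyticAt ℂ (jacobiSn κ) (u - v) ∧
    jacobiSn κ (u - v) * (1 - κ ^ 2 * jacobiSn κ u ^ 2 * jacobiSn κ v ^ 2) =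
      jacobiSn κ u * deriv (jacobiSn κ) v - jacobiSn κ v * deriv (jacobiSn κ) u := by
  have := jacobiSn_add hu (analyticAt_jacobiSn_neg hv) (by simpa [jacobiSn_neg] using hD)
  simpa [jacobiSn_neg, deriv_jacobiSn_neg, ← sub_eq_add_neg] using this

end JacobiSn

/-! ### A primitive of `-sn²` and its addition formula -/

/-- A germ at the origin that extends meromorphically to arbitrarily large discs is the germ of a
meromorphic function on the plane. -/
theorem exists_meromorphicNFAt_of_germ {F : ℂ → ℂ} (hF : AnalyticAt ℂ F 0) {r : ℝ} (hr : 0 < r)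
    (hext : ∀ n : ℕ, ∃ g : ℂ → ℂ, MeromorphicOn g (Metric.ball 0 (2 ^ n * r)) ∧ g =ᶠ[𝓝 0] F) :
    ∃ f : ℂ → ℂ, (∀ z, MeromorphicNFAt f z) ∧ f =ᶠ[𝓝 0] F := by
  choose g hg hgs using hext
  let R : ℕ → ℝ := fun n => 2 ^ n * r
  have hR : ∀ n, 0 < R n := fun n => by positivity
  let G : ℕ → ℂ → ℂ := fun n => toMeromorphicNFOn (g n) (Metric.ball 0 (R n))
  have hG : ∀ n, MeromorphicNFOn (G n) (Metric.ball 0 (R n)) :=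
    fun n => meromorphicNFOn_toMeromorphicNFOn _ _
  have hGg : ∀ n, ∀ u ∈ Metric.ball (0 : ℂ) (R n), G n =ᶠ[𝓝[≠] u] g n :=
    fun n u hu => (hg n).toMeromorphicNFOn_eq_self_on_nhdsNE hu
  have hmono : ∀ m n, m ≤ n → Metric.ball (0 : ℂ) (R m) ⊆ Metric.ball 0 (R n) := by
    intro m n hmn
    apply Metric.ball_subset_ball
    exact mul_le_mul_of_nonneg_right (pow_le_pow_right₀ one_le_two hmn) hr.le
  have hagree : ∀ m n, m ≤ n → ∀ u ∈ Metric.ball (0 : ℂ) (R m), G m =ᶠ[𝓝 u] G n := by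
    intro m n hmn u hu
    rw [← (hG m hu).eventuallyEq_nhdsNE_iff_eventuallyEq_nhds (hG n (hmono m n hmn hu))]
    refine (hGg m u hu).trans (EventuallyEq.trans ?_ (hGg n u (hmono m n hmn hu)).symm)
    exact meromorphic_identity (hR m) (hg m) ((hg n).mono_set (hmono m n hmn))
      ((hgs m).trans (hgs n).symm) hu
  have hcov : ∀ u : ℂ, ∃ n, u ∈ Metric.ball (0 : ℂ) (R n) := by
    intro u
    obtain ⟨n, hn⟩ := pow_unbounded_of_one_lt (‖u‖ / r) one_lt_two
    exact ⟨n, by simpa [R] using (div_lt_iff₀ hr).1 hn⟩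
  choose N hN using hcov
  let f : ℂ → ℂ := fun u => G (N u) u
  have hf : ∀ n, ∀ u ∈ Metric.ball (0 : ℂ) (R n), f =ᶠ[𝓝 u] G n := by
    intro n u hu
    filter_upwards [Metric.isOpen_ball.mem_nhds hu] with v hv
    rcases le_total (N v) n with h | h
    · exact (hagree _ _ h v (hN v)).eq_of_nhds
    · exact (hagree _ _ h v hv).eq_of_nhds.symm
  refine ⟨f, fun u => ?_, ?_⟩
  · rw [meromorphicNFAt_congr (hf _ u (hN u))]
    exact hG _ (hN u)
  · have h0 : (0 : ℂ) ∈ Metric.ball (0 : ℂ) (R 0) := Metric.mem_ball_self (hR 0)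
    refine (hf 0 0 h0).trans ?_
    rw [← (hG 0 h0).eventuallyEq_nhdsNE_iff_eventuallyEq_nhds hF.meromorphicNFAt]
    exact (hGg 0 0 h0).trans ((hgs 0).filter_mono nhdsWithin_le_nhds)

section Primitive

variable {κ : ℂ}

/-- Multiplying the subtraction formula by its conjugate numerator. -/
theorem jacobiSn_sub_mul {u v : ℂ} (hu : AnalyticAt ℂ (jacobiSn κ) u)
    (hv : AnalyticAt ℂ (jacobiSn κ) v)
    (hD : 1 - κ ^ 2 * jacobiSn κ u ^ 2 * jacobiSn κ v ^ 2 ≠ 0) :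
    jacobiSn κ (u - v) * (jacobiSn κ u * deriv (jacobiSn κ) v +
      jacobiSn κ v * deriv (jacobiSn κ) u) = jacobiSn κ u ^ 2 - jacobiSn κ v ^ 2 := by
  have h := (jacobiSn_sub hu hv hD).2
  have q1 := deriv_jacobiSn_sq hu
  have q2 := deriv_jacobiSn_sq hv
  apply mul_left_cancel₀ hD
  linear_combination (jacobiSn κ u * deriv (jacobiSn κ) v +
    jacobiSn κ v * deriv (jacobiSn κ) u) * h + jacobiSn κ u ^ 2 * q2 - jacobiSn κ v ^ 2 * q1

variable (κ) in
/-- The duplication formula `h (2 u) = 2 h u - sn² u sn (2 u)` extends a local primitive `h` of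
`-sn²` to the whole plane. -/
theorem exists_primitive_neg_jacobiSn_sq : ∃ h : ℂ → ℂ, (∀ z, MeromorphicNFAt h z) ∧
    AnalyticAt ℂ h 0 ∧ h 0 = 0 ∧ ∀ᶠ u in 𝓝 0, HasDerivAt h (-jacobiSn κ u ^ 2) u := by
  have hs0 := analyticAt_jacobiSn_zero κ
  have hm := meromorphicAt_jacobiSn κ
  obtain ⟨r, hr, hball⟩ := Metric.eventually_nhds_iff_ball.1 hs0.eventually_analyticAt
  have hd : DifferentiableOn ℂ (fun u => -jacobiSn κ u ^ 2) (Metric.ball 0 r) := fun t ht =>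
    ((hball t ht).pow 2).neg.differentiableAt.differentiableWithinAt
  obtain ⟨F, hF0, hF⟩ := hd.isExactOn_ball.with_val_at 0 0
  have hnhds : Metric.ball (0 : ℂ) r ∈ 𝓝 (0 : ℂ) := Metric.ball_mem_nhds _ hr
  have hFd : DifferentiableOn ℂ F (Metric.ball 0 r) :=
    fun t ht => (hF t ht).differentiableAt.differentiableWithinAt
  have hFa : AnalyticAt ℂ F 0 := hFd.analyticAt hnhds
  have hFe : ∀ᶠ u in 𝓝 0, HasDerivAt F (-jacobiSn κ u ^ 2) u := by
    filter_upwards [hnhds] with t ht using hF t ht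
  have hhalf : Tendsto (fun u : ℂ => u / 2) (𝓝 0) (𝓝 0) := by
    have : ContinuousAt (fun u : ℂ => u / 2) 0 := by fun_prop
    simpa [ContinuousAt] using this
  have hdup : (fun u => 2 * F (u / 2) - jacobiSn κ (u / 2) ^ 2 * jacobiSn κ u) =ᶠ[𝓝 0] F := by
    have hDne : ∀ᶠ u in 𝓝 (0 : ℂ),
        1 - κ ^ 2 * jacobiSn κ u ^ 2 * jacobiSn κ (u / 2) ^ 2 ≠ 0 := by
      have h1 := hs0.continuousAt
      have h2 : ContinuousAt (fun u => jacobiSn κ (u / 2)) 0 :=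
        ContinuousAt.comp_of_eq (f := fun u : ℂ => u / 2) h1 (by fun_prop) (by simp)
      have : ContinuousAt
          (fun u => 1 - κ ^ 2 * jacobiSn κ u ^ 2 * jacobiSn κ (u / 2) ^ 2) 0 := by fun_prop
      apply this.eventually_ne
      simp [jacobiSn_zero]
    have hder : ∀ᶠ u in 𝓝 (0 : ℂ), HasDerivAt
        (fun u => 2 * F (u / 2) - jacobiSn κ (u / 2) ^ 2 * jacobiSn κ u - F u) 0 u := by
      filter_upwards [hs0.eventually_analyticAt, hhalf.eventually hs0.eventually_analyticAt, hFe,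
        hhalf.eventually hFe, hDne] with u a b c d e
      have hh : HasDerivAt (fun u : ℂ => u / 2) (1 / 2) u := (hasDerivAt_id u).div_const 2
      have e1 := a.differentiableAt.hasDerivAt
      have e2 : HasDerivAt (fun u => jacobiSn κ (u / 2)) (deriv (jacobiSn κ) (u / 2) * (1 / 2)) u :=
        b.differentiableAt.hasDerivAt.comp u hh
      have e3 : HasDerivAt (fun u => F (u / 2)) (-jacobiSn κ (u / 2) ^ 2 * (1 / 2)) u :=
        HasDerivAt.comp (h₂ := F) (h := fun u : ℂ => u / 2) u d hh
      refine HasDerivAt.congr_deriv (((e3.const_mul 2).sub ((e2.pow 2).mul e1)).sub c) ?_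
      have key := jacobiSn_sub_mul a b e
      rw [sub_half] at key
      simp only [Pi.pow_apply]
      push_cast
      linear_combination -key
    filter_upwards [eventually_eq_of_deriv_eq_zero hder] with u hu
    simpa [hF0, jacobiSn_zero, sub_eq_zero] using hu
  obtain ⟨h, hh, hhF⟩ := exists_meromorphicNFAt_of_germ hFa hr (fun n => by
    induction n with
    | zero => exact ⟨F, fun u hu => (hFd.analyticAt
        (Metric.isOpen_ball.mem_nhds (by simpa using hu))).meromorphicAt, EventuallyEq.rfl⟩
    | succ n ih =>
      obtain ⟨g, h1, h2⟩ := ih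
      refine ⟨fun u => 2 * g (u / 2) - jacobiSn κ (u / 2) ^ 2 * jacobiSn κ u, fun u hu => ?_, ?_⟩
      · have hu' : u / 2 ∈ Metric.ball (0 : ℂ) (2 ^ n * r) := by
          simp only [mem_ball_zero_iff, norm_div, Complex.norm_ofNat, pow_succ] at hu ⊢
          linarith
        have hA : AnalyticAt ℂ (fun u : ℂ => u / 2) u := by fun_prop
        have m1 : MeromorphicAt (fun u => g (u / 2)) u :=
          MeromorphicAt.comp_analyticAt (g := fun u : ℂ => u / 2) (h1 _ hu') hA
        have m2 : MeromorphicAt (fun u => jacobiSn κ (u / 2)) u :=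
          MeromorphicAt.comp_analyticAt (g := fun u : ℂ => u / 2) (hm _) hA
        exact ((MeromorphicAt.const 2 u).mul m1).sub ((m2.pow 2).mul (hm u))
      · refine EventuallyEq.trans ?_ hdup
        filter_upwards [hhalf.eventually h2] with u hu
        rw [hu])
  refine ⟨h, hh, hFa.congr hhF.symm, hhF.eq_of_nhds.trans hF0, ?_⟩
  filter_upwards [hFe, hhF.eventually_nhds] with u a b
  exact a.congr_of_eventuallyEq b

variable (κ) in
/-- A function with `h u + h v - h (u + v) = sn u sn v sn (u + v)`, regular off the poles of `sn`:
a primitive of `-sn²`. -/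
theorem exists_add_formula : ∃ h : ℂ → ℂ, ∀ u v, AnalyticAt ℂ (jacobiSn κ) u →
    AnalyticAt ℂ (jacobiSn κ) v → AnalyticAt ℂ (jacobiSn κ) (u + v) →
    h u + h v - h (u + v) = jacobiSn κ u * jacobiSn κ v * jacobiSn κ (u + v) := by
  obtain ⟨h, hnf, ha0, h0, hder0⟩ := exists_primitive_neg_jacobiSn_sq κ
  have hm := meromorphicAt_jacobiSn κ
  have hs0 := analyticAt_jacobiSn_zero κ
  have hhm : ∀ z, MeromorphicAt h z := fun z => (hnf z).meromorphicAt
  have hder : ∀ {u}, AnalyticAt ℂ (jacobiSn κ) u → AnalyticAt ℂ h u →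
      HasDerivAt h (-jacobiSn κ u ^ 2) u := fun {u} hu hu' => by
    have := eq_of_eventuallyEq_nhds_zero (f := deriv h) (g := fun u => -jacobiSn κ u ^ 2)
      (fun z => (hhm z).deriv) (fun z => ((hm z).pow 2).neg)
      (hder0.mono fun u hu => hu.deriv) hu'.deriv.continuousAt (hu.pow 2).neg.continuousAt
    exact this ▸ hu'.differentiableAt.hasDerivAt
  -- Both sides are `0` at `u = 0`, and near `u = 0` they have the same derivative.
  have key : ∀ u v, AnalyticAt ℂ (jacobiSn κ) u → AnalyticAt ℂ (jacobiSn κ) v →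
      AnalyticAt ℂ (jacobiSn κ) (u + v) → AnalyticAt ℂ h u → AnalyticAt ℂ h v →
      AnalyticAt ℂ h (u + v) →
      h u = h (u + v) - h v + jacobiSn κ u * jacobiSn κ v * jacobiSn κ (u + v) := by
    intro u v su sv suv hu hv huv
    have hA : ∀ z, AnalyticAt ℂ (fun t : ℂ => t + v) z := fun z => by fun_prop
    have hsa : ∀ z, AnalyticAt ℂ (jacobiSn κ) (z + v) →
      AnalyticAt ℂ (fun t => jacobiSn κ (t + v)) z := fun z hz => hz.comp_of_eq (hA z) rfl
    have hha : ∀ z, AnalyticAt ℂ h (z + v) →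
      AnalyticAt ℂ (fun t => h (t + v)) z := fun z hz => hz.comp_of_eq (hA z) rfl
    refine eq_of_eventuallyEq_nhds_zero (f := h)
      (g := fun t => h (t + v) - h v + jacobiSn κ t * jacobiSn κ v * jacobiSn κ (t + v)) hhm
      (fun z => (((hhm _).comp_analyticAt (g := fun t => t + v) (hA z)).sub
        (MeromorphicAt.const _ z)).add (((hm z).mul (MeromorphicAt.const _ z)).mul
          ((hm _).comp_analyticAt (g := fun t => t + v) (hA z)))) ?_ hu.continuousAt
      (((hha u huv).sub analyticAt_const).add
        ((su.mul analyticAt_const).mul (hsa u suv))).continuousAt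
    have hlim : Tendsto (fun t : ℂ => t + v) (𝓝 0) (𝓝 v) := by
      have : ContinuousAt (fun t : ℂ => t + v) 0 := by fun_prop
      simpa [ContinuousAt] using this
    have hDne : ∀ᶠ t in 𝓝 (0 : ℂ),
        1 - κ ^ 2 * jacobiSn κ (t + v) ^ 2 * jacobiSn κ t ^ 2 ≠ 0 := by
      have h1 := hs0.continuousAt
      have h2 : ContinuousAt (fun t => jacobiSn κ (t + v)) 0 :=
        (hsa 0 (by simpa using sv)).continuousAt
      have : ContinuousAt
          (fun t => 1 - κ ^ 2 * jacobiSn κ (t + v) ^ 2 * jacobiSn κ t ^ 2) 0 := by fun_prop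
      apply this.eventually_ne
      simp [jacobiSn_zero]
    have hconst : ∀ᶠ t in 𝓝 (0 : ℂ), HasDerivAt (fun t => h t -
        (h (t + v) - h v + jacobiSn κ t * jacobiSn κ v * jacobiSn κ (t + v))) 0 t := by
      filter_upwards [hs0.eventually_analyticAt, ha0.eventually_analyticAt,
        hlim.eventually sv.eventually_analyticAt, hlim.eventually hv.eventually_analyticAt, hDne]
        with t a b c d e
      have e1 := a.differentiableAt.hasDerivAt
      have e2 := c.differentiableAt.hasDerivAt.comp_add_const t v
      have e3 := (hder c d).comp_add_const t v
      refine HasDerivAt.congr_deriv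
        ((hder a b).sub ((e3.sub_const (h v)).add ((e1.mul_const (jacobiSn κ v)).mul e2))) ?_
      have := jacobiSn_sub_mul c a e
      rw [add_sub_cancel_left] at this
      linear_combination -this
    filter_upwards [eventually_eq_of_deriv_eq_zero hconst] with t ht
    simpa [h0, jacobiSn_zero, sub_eq_zero] using ht
  -- A small regular shift `v` exhibits `h` near a regular point of `sn` as an analytic function.
  have hreg : ∀ u, AnalyticAt ℂ (jacobiSn κ) u → AnalyticAt ℂ h u := by
    intro u su
    have hlim : Tendsto (fun t : ℂ => u + t) (𝓝[≠] 0) (𝓝[≠] u) := by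
      refine tendsto_nhdsWithin_of_tendsto_nhds_of_eventually_within _ ?_ ?_
      · have : ContinuousAt (fun t : ℂ => u + t) 0 := by fun_prop
        have h2 : Tendsto (fun t : ℂ => u + t) (𝓝 0) (𝓝 u) := by simpa [ContinuousAt] using this
        exact h2.mono_left nhdsWithin_le_nhds
      · filter_upwards [self_mem_nhdsWithin] with t ht
        simpa using ht
    obtain ⟨v, ⟨sv, hv⟩, suv, huv⟩ := (((hm 0).eventually_analyticAt.and
      (hhm 0).eventually_analyticAt).and (hlim.eventually ((hm u).eventually_analyticAt.and
        (hhm u).eventually_analyticAt))).exists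
    have hA : AnalyticAt ℂ (fun t : ℂ => t + v) u := by fun_prop
    have hlim2 : Tendsto (fun t : ℂ => t + v) (𝓝[≠] u) (𝓝 (u + v)) :=
      (by fun_prop : ContinuousAt (fun t : ℂ => t + v) u).tendsto.mono_left nhdsWithin_le_nhds
    refine ((hnf u).analyticAt_of_eventuallyEq_nhdsNE
      (g := fun t => h (t + v) - h v + jacobiSn κ t * jacobiSn κ v * jacobiSn κ (t + v))
      (((huv.comp_of_eq hA rfl).sub analyticAt_const).add
        ((su.mul analyticAt_const).mul (suv.comp_of_eq hA rfl))) ?_).1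
    filter_upwards [su.eventually_analyticAt.filter_mono nhdsWithin_le_nhds,
      (hhm u).eventually_analyticAt, hlim2.eventually suv.eventually_analyticAt,
      hlim2.eventually huv.eventually_analyticAt] with t a b c d
    exact key t v a sv c b hv d
  refine ⟨h, fun u v su sv suv => ?_⟩
  rw [key u v su sv suv (hreg u su) (hreg v sv) (hreg _ suv)]
  ring

end Primitive

/-! ### The values of the elliptic sine -/

section Values

variable {κ : ℂ}

/-- The values of `sn` other than its branch values fill the complement of the branch values: they
form a set that is open there, and also closed. For the latter, let `s` be a limit of values, with
`g² = (1 - s²) (1 - κ² s²) ≠ 0`. The function `t ↦ (s sn' t + g sn t) / (1 - κ² s² sn² t)`, which the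
addition theorem would make a translate of `sn`, covers a neighbourhood of `s`, so one of its values
near `s` is `sn u` for some `u`; subtracting `t` again shows that `s = sn (u ∓ t)`. -/
theorem exists_jacobiSn_eq {s : ℂ} (hs : (1 - s ^ 2) * (1 - κ ^ 2 * s ^ 2) ≠ 0) :
    ∃ u, AnalyticAt ℂ (jacobiSn κ) u ∧ jacobiSn κ u = s := by
  let q : ℂ → ℂ := fun s => (1 - s ^ 2) * (1 - κ ^ 2 * s ^ 2)
  let Y : Set ℂ := {s | q s ≠ 0}
  let S : Set ℂ := {s | ∃ u, AnalyticAt ℂ (jacobiSn κ) u ∧ jacobiSn κ u = s}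
  have hs0 := analyticAt_jacobiSn_zero κ
  have hYconn : IsPreconnected Y := by
    have hfin : {s : ℂ | q s = 0}.Finite := by
      let p : Polynomial ℂ := (1 - Polynomial.X ^ 2) * (1 - Polynomial.C (κ ^ 2) * Polynomial.X ^ 2)
      have hp : p ≠ 0 := by
        intro h
        have : p.eval 0 = 0 := by rw [h]; simp
        simp [p] at this
      refine (p.rootSet_finite ℂ).subset fun s hs => ?_
      rw [Polynomial.mem_rootSet]
      refine ⟨hp, ?_⟩
      simpa [p, q] using hs
    have := (hfin.countable.isConnected_compl_of_one_lt_rank (by simp : 1 < Module.rank ℝ ℂ)).2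
    exact this
  have hopen : ∀ s ∈ Y ∩ S, S ∈ 𝓝 s := by
    rintro _ ⟨hq, u, hu, rfl⟩
    have hne : deriv (jacobiSn κ) u ≠ 0 := by
      intro h
      apply hq
      have := deriv_jacobiSn_sq hu
      rw [h] at this
      simpa [q] using this.symm
    have hmap := hu.hasStrictDerivAt.map_nhds_eq hne
    rw [← hmap, mem_map]
    filter_upwards [hu.eventually_analyticAt] with v hv using ⟨v, hv, rfl⟩
  have hclosed : ∀ s ∈ Y, s ∈ closure S → s ∈ S := by
    intro s hsY hcl
    obtain ⟨g, hg⟩ := IsAlgClosed.exists_pow_nat_eq (q s) (n := 2) two_pos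
    have hg0 : g ≠ 0 := by
      rintro rfl
      exact hsY (by simpa using hg.symm)
    let D : ℂ → ℂ := fun t => 1 - κ ^ 2 * s ^ 2 * jacobiSn κ t ^ 2
    let φ : ℂ → ℂ := fun t => (s * deriv (jacobiSn κ) t + g * jacobiSn κ t) / D t
    have hD0 : D 0 ≠ 0 := by simp [D, jacobiSn_zero]
    have hDa : AnalyticAt ℂ D 0 := analyticAt_const.sub (analyticAt_const.mul (hs0.pow 2))
    have hNa : AnalyticAt ℂ (fun t => s * deriv (jacobiSn κ) t + g * jacobiSn κ t) 0 :=
      (analyticAt_const.mul hs0.deriv).add (analyticAt_const.mul hs0)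
    have hφa : AnalyticAt ℂ φ 0 := hNa.div hDa hD0
    have hφ0 : φ 0 = s := by simp [φ, D, jacobiSn_zero, deriv_jacobiSn_zero]
    have hφ' : deriv φ 0 = g := by
      have e1 := (isJacobiSn_jacobiSn κ).hasDerivAt_zero
      have e2 := hs0.deriv.differentiableAt.hasDerivAt
      rw [deriv_deriv_jacobiSn hs0] at e2
      have e3 := ((e2.const_mul s).add (e1.const_mul g)).div
        (((e1.pow 2).const_mul (κ ^ 2 * s ^ 2)).const_sub 1) hD0
      refine (HasDerivAt.congr_deriv (f := φ) e3 ?_).deriv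
      simp [jacobiSn_zero]
    have hgood : ∀ᶠ t in 𝓝 (0 : ℂ), AnalyticAt ℂ (jacobiSn κ) t ∧ D t ≠ 0 ∧
        1 - κ ^ 2 * φ t ^ 2 * jacobiSn κ t ^ 2 ≠ 0 := by
      refine hs0.eventually_analyticAt.and ((hDa.continuousAt.eventually_ne hD0).and ?_)
      have h1 := hs0.continuousAt
      have h2 := hφa.continuousAt
      have : ContinuousAt (fun t => 1 - κ ^ 2 * φ t ^ 2 * jacobiSn κ t ^ 2) 0 := by fun_prop
      apply this.eventually_ne
      simp [jacobiSn_zero]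
    have himage : φ '' {t | AnalyticAt ℂ (jacobiSn κ) t ∧ D t ≠ 0 ∧
        1 - κ ^ 2 * φ t ^ 2 * jacobiSn κ t ^ 2 ≠ 0} ∈ 𝓝 s := by
      have := hφa.hasStrictDerivAt.map_nhds_eq (hφ' ▸ hg0)
      rw [hφ0] at this
      rw [← this]
      exact image_mem_map hgood
    obtain ⟨_, ⟨t, ⟨ht, hDt, hE⟩, rfl⟩, u, hu, hφt⟩ := mem_closure_iff_nhds.1 hcl _ himage
    have qt := deriv_jacobiSn_sq ht
    have qu := deriv_jacobiSn_sq hu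
    have hφD : φ t * D t = s * deriv (jacobiSn κ) t + g * jacobiSn κ t := div_mul_cancel₀ _ hDt
    rw [← hφt] at hφD hE
    -- The relation between the squares of the three values is symmetric in `s` and `φ t`.
    have hsymm : jacobiSn κ u ^ 2 + s ^ 2 - jacobiSn κ t ^ 2 -
        κ ^ 2 * jacobiSn κ u ^ 2 * s ^ 2 * jacobiSn κ t ^ 2 =
        2 * jacobiSn κ u * s * deriv (jacobiSn κ) t := by
      apply mul_left_cancel₀ hDt
      simp only [q] at hg
      simp only [D] at hφD ⊢
      linear_combination (jacobiSn κ u * (1 - κ ^ 2 * s ^ 2 * jacobiSn κ t ^ 2) -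
        s * deriv (jacobiSn κ) t + g * jacobiSn κ t) * hφD +
        jacobiSn κ t ^ 2 * hg - s ^ 2 * qt
    have hsq : (jacobiSn κ u * deriv (jacobiSn κ) t -
        s * (1 - κ ^ 2 * jacobiSn κ u ^ 2 * jacobiSn κ t ^ 2)) ^ 2 =
        (jacobiSn κ t * deriv (jacobiSn κ) u) ^ 2 := by
      linear_combination (1 - κ ^ 2 * jacobiSn κ u ^ 2 * jacobiSn κ t ^ 2) * hsymm +
        jacobiSn κ u ^ 2 * qt - jacobiSn κ t ^ 2 * qu
    rcases sq_eq_sq_iff_eq_or_eq_neg.1 hsq with h | h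
    · obtain ⟨ha, hadd⟩ := jacobiSn_sub hu ht hE
      refine ⟨u - t, ha, mul_right_cancel₀ hE ?_⟩
      linear_combination hadd + h
    · obtain ⟨ha, hadd⟩ := jacobiSn_add hu ht hE
      refine ⟨u + t, ha, mul_right_cancel₀ hE ?_⟩
      linear_combination hadd + h
  have hYopen : IsOpen Y := isOpen_ne_fun (by fun_prop) continuous_const
  have hU : IsOpen (Y ∩ S) := isOpen_iff_mem_nhds.2 fun s h =>
    inter_mem (hYopen.mem_nhds h.1) (hopen s h)
  have hsub : Y ⊆ Y ∩ S := hYconn.subset_of_closure_inter_subset hU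
    ⟨0, by simp [Y, q], by simp [Y, q], 0, hs0, jacobiSn_zero κ⟩
    fun s h => ⟨h.2, hclosed s h.2 (closure_mono Set.inter_subset_right h.1)⟩
  exact (hsub hs).2

/-- Since `sn` is odd and `sn'` is even, the sign of the logarithmic derivative can be prescribed
along with the square of `sn`. -/
theorem exists_jacobiSn_sq_eq {σ g : ℂ} (hg : g ≠ 0)
    (h : (g * σ) ^ 2 = (1 - σ ^ 2) * (1 - κ ^ 2 * σ ^ 2)) (hσ : σ ≠ 0) :
    ∃ u, AnalyticAt ℂ (jacobiSn κ) u ∧ jacobiSn κ u ^ 2 = σ ^ 2 ∧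
      deriv (jacobiSn κ) u = g * jacobiSn κ u := by
  obtain ⟨u, hu, rfl⟩ := exists_jacobiSn_eq (h ▸ pow_ne_zero 2 (mul_ne_zero hg hσ))
  rcases sq_eq_sq_iff_eq_or_eq_neg.1 ((deriv_jacobiSn_sq hu).trans h.symm) with h | h
  · exact ⟨u, hu, rfl, h⟩
  · exact ⟨-u, analyticAt_jacobiSn_neg hu, by rw [jacobiSn_neg, neg_sq],
      by rw [deriv_jacobiSn_neg, jacobiSn_neg, h, mul_neg]⟩

end Values

/-! ### Solving for the curve and the points -/

section Algebra

variable {R : Type*} [CommRing R]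

/-- The value of a 2-cocycle with values `n i j` on the triangles `i j 4` on the triangle with
vertices in `{0, 1, 2, 3} \ {l}`. -/
def baseValue (n : Fin 4 → Fin 4 → R) : Fin 4 → R :=
  ![n 1 2 + n 2 3 - n 1 3, n 0 2 + n 2 3 - n 0 3, n 0 1 + n 1 3 - n 0 3, n 0 1 + n 1 2 - n 0 2]

/-- The product of the `n i j` over the edges at a vertex. -/
def starProd (n : Fin 4 → Fin 4 → R) : Fin 4 → R :=
  ![n 0 1 * n 0 2 * n 0 3, n 0 1 * n 1 2 * n 1 3, n 0 2 * n 1 2 * n 2 3, n 0 3 * n 1 3 * n 2 3]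

/-- The product of the `n i j` over all six edges. -/
def edgeProd (n : Fin 4 → Fin 4 → R) : R := n 0 1 * n 0 2 * n 0 3 * n 1 2 * n 1 3 * n 2 3

/-- The Pfaffian of the antisymmetric matrix with entries `n i j` above the diagonal. -/
def pfaffianFour (n : Fin 4 → Fin 4 → R) : R := n 0 1 * n 2 3 - n 0 2 * n 1 3 + n 0 3 * n 1 2

/-- The cubic polynomials `G i` for which the points sought have `y / x = P * G i / (2 * N)`, with `N`
the product of the `n i j` and `P` a common factor. They solve the linear equations for `G i + G j`
and `G j - G i` in `edge_equations`. -/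
def slopeNum (n : Fin 4 → Fin 4 → R) : Fin 4 → R :=
  let q := baseValue n
  let d := pfaffianFour n
  ![q 0 * n 0 2 * n 0 3 - q 1 * n 1 2 * n 1 3 - (n 2 3 * q 2 * q 3 - d * n 0 1),
    q 0 * n 0 2 * n 0 3 - q 1 * n 1 2 * n 1 3 + (n 2 3 * q 2 * q 3 - d * n 0 1),
    q 2 * n 0 2 * n 1 2 - q 3 * n 0 3 * n 1 3 - (n 0 1 * q 0 * q 1 - d * n 2 3),
    q 2 * n 0 2 * n 1 2 - q 3 * n 0 3 * n 1 3 + (n 0 1 * q 0 * q 1 - d * n 2 3)]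

/-- The coefficient `A` of the curve `y² = 1 + A x² + B x⁴` sought, up to the factor
`P ^ 2 / (4 * N ^ 2)` in the notation of `slopeNum`. -/
def curveNum (n : Fin 4 → Fin 4 → R) : R :=
  slopeNum n 0 ^ 2 - 4 * (baseValue n 1 * baseValue n 2 * baseValue n 3) *
    (n 1 2 * n 1 3 * n 2 3) - 4 * pfaffianFour n * baseValue n 0 * starProd n 0

/-- The polynomial whose nonvanishing makes the 2-cocycle with values `n i j` on the triangles
`i j 4` an elliptic one: the `slopeNum n i` keep the points off the branch points, the last six
factors keep the differences of the points off the poles, and the one before them keeps the curve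
nonsingular. -/
def genericityPoly (n : Fin 4 → Fin 4 → R) : R :=
  edgeProd n * pfaffianFour n * (∏ i, baseValue n i) * (∏ i, slopeNum n i) *
    (curveNum n ^ 2 - 64 * pfaffianFour n * edgeProd n * ∏ i, baseValue n i) *
    ((n 2 3 * baseValue n 2 * baseValue n 3 - pfaffianFour n * n 0 1) *
      (n 1 3 * baseValue n 1 * baseValue n 3 - pfaffianFour n * n 0 2) *
      (n 1 2 * baseValue n 1 * baseValue n 2 - pfaffianFour n * n 0 3) *
      (n 0 3 * baseValue n 0 * baseValue n 3 - pfaffianFour n * n 1 2) *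
      (n 0 2 * baseValue n 0 * baseValue n 2 - pfaffianFour n * n 1 3) *
      (n 0 1 * baseValue n 0 * baseValue n 1 - pfaffianFour n * n 2 3))

theorem map_genericityPoly {R' : Type*} [CommRing R'] (f : R →+* R') (n : Fin 4 → Fin 4 → R) :
    f (genericityPoly n) = genericityPoly fun i j => f (n i j) := by
  simp [genericityPoly, curveNum, slopeNum, pfaffianFour, edgeProd, starProd, baseValue,
    Fin.prod_univ_four, map_ofNat]

/-- The equations attached to an edge `i j` with opposite edge `k l`, for
`S i = P q i m i / N`, `γ i = P G i / (2 N)` and `B = P d / N`, where `P ^ 3 = N ^ 2 / ∏ q`. -/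
theorem edge_equations {P N d qi qj qk ql mi mj Gi Gj nij nkl : ℂ} (hN : N ≠ 0)
    (hP : P ^ 3 * (qi * qj * qk * ql) = N ^ 2) (hm : mi * mj * nkl = nij * N)
    (hsub : Gj - Gi = 2 * (nkl * qk * ql - d * nij))
    (hadd : (Gi + Gj) * nij = 2 * (qi * mi - qj * mj)) :
    (P * qi * mi / N) * (P * qj * mj / N) * (P * Gj / (2 * N) - P * Gi / (2 * N)) =
        nij * (1 - P * d / N * (P * qi * mi / N) * (P * qj * mj / N)) ∧
      (P * Gi / (2 * N) + P * Gj / (2 * N)) * nij = P * qi * mi / N - P * qj * mj / N := by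
  constructor
  · field_simp
    linear_combination P ^ 3 * qi * qj * mi * mj * hsub + 2 * N ^ 2 * hm +
      2 * mi * mj * nkl * hP
  · field_simp
    linear_combination P * hadd

/-- A solution of the algebraic equations: points with squared abscissas `S i` and slopes `γ i = y / x` on
the curve `y² = 1 + A x² + B x⁴`, whose differences have the abscissas that the cocycle requires. -/
theorem exists_curve_and_points {n : Fin 4 → Fin 4 → ℂ} (hn : genericityPoly n ≠ 0) :
    ∃ (A B : ℂ) (S γ : Fin 4 → ℂ), B ≠ 0 ∧ A ^ 2 ≠ 4 * B ∧ (∀ i, S i ≠ 0) ∧ (∀ i, γ i ≠ 0) ∧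
      (∀ i, γ i ^ 2 * S i = 1 + A * S i + B * S i ^ 2) ∧
      (∀ i j, i < j → 1 - B * S i * S j ≠ 0 ∧
        S i * S j * (γ j - γ i) = n i j * (1 - B * S i * S j)) ∧
      ∀ i j k, i < j → j < k →
        S i * S j * S k * (n i j + n j k - n i k) = n i j * n i k * n j k := by
  simp only [genericityPoly, mul_ne_zero_iff, Finset.prod_ne_zero_iff, Finset.mem_univ,
    true_implies] at hn
  obtain ⟨⟨⟨⟨⟨hN, hd⟩, hq⟩, hG⟩, hdisc⟩, ⟨⟨⟨⟨h01, h02⟩, h03⟩, h12⟩, h13⟩, h23⟩ := hn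
  obtain ⟨N, hNdef⟩ : ∃ N, N = edgeProd n := ⟨_, rfl⟩
  obtain ⟨d, hddef⟩ : ∃ d, d = pfaffianFour n := ⟨_, rfl⟩
  rw [← hNdef] at hN hdisc
  rw [← hddef] at hd hdisc h01 h02 h03 h12 h13 h23
  have hQ : ∏ i, baseValue n i ≠ 0 := Finset.prod_ne_zero_iff.2 fun i _ => hq i
  -- The choice of the cube root is immaterial: it corresponds to scaling the abscissas.
  obtain ⟨P, hP⟩ := IsAlgClosed.exists_pow_nat_eq (N ^ 2 / ∏ i, baseValue n i) (n := 3) three_pos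
  rw [eq_div_iff hQ] at hP
  have hP0 : P ≠ 0 := by
    rintro rfl
    exact pow_ne_zero 2 hN (by simpa using hP.symm)
  have hn' := hN
  rw [hNdef, edgeProd] at hn'
  simp only [mul_ne_zero_iff] at hn'
  obtain ⟨⟨⟨⟨⟨n01, n02⟩, n03⟩, n12⟩, n13⟩, n23⟩ := hn'
  have hm : ∀ i, starProd n i ≠ 0 := by
    simp [Fin.forall_fin_succ, starProd, *]
  let S : Fin 4 → ℂ := fun i => P * baseValue n i * starProd n i / N
  let γ : Fin 4 → ℂ := fun i => P * slopeNum n i / (2 * N)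
  let B : ℂ := P * d / N
  have hS : ∀ i, S i ≠ 0 := fun i => div_ne_zero (mul_ne_zero (mul_ne_zero hP0 (hq i)) (hm i)) hN
  have hedge : ∀ i j, i < j → n i j ≠ 0 ∧ slopeNum n j - slopeNum n i ≠ 0 ∧
      S i * S j * (γ j - γ i) = n i j * (1 - B * S i * S j) ∧ (γ i + γ j) * n i j = S i - S j := by
    have aux : ∀ i j k l, n i j ≠ 0 →
        n k l * baseValue n k * baseValue n l - d * n i j ≠ 0 →
        ∏ a, baseValue n a = baseValue n i * baseValue n j * baseValue n k * baseValue n l →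
        starProd n i * starProd n j * n k l = n i j * N →
        slopeNum n j - slopeNum n i = 2 * (n k l * baseValue n k * baseValue n l - d * n i j) →
        (slopeNum n i + slopeNum n j) * n i j =
          2 * (baseValue n i * starProd n i - baseValue n j * starProd n j) →
        n i j ≠ 0 ∧ slopeNum n j - slopeNum n i ≠ 0 ∧
          S i * S j * (γ j - γ i) = n i j * (1 - B * S i * S j) ∧
          (γ i + γ j) * n i j = S i - S j := by
      intro i j k l h1 h2 h3 h4 h5 h6
      rw [h3] at hP
      exact ⟨h1, h5 ▸ mul_ne_zero two_ne_zero h2, edge_equations hN hP h4 h5 h6⟩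
    have e01 := aux 0 1 2 3 n01 h01 (by rw [Fin.prod_univ_four])
      (by simp [starProd, hNdef, edgeProd]; ring) (by simp [slopeNum, hddef]; ring)
      (by simp [slopeNum, starProd]; ring)
    have e02 := aux 0 2 1 3 n02 h02 (by rw [Fin.prod_univ_four]; ring)
      (by simp [starProd, hNdef, edgeProd]; ring)
      (by simp [slopeNum, hddef, pfaffianFour, baseValue]; ring)
      (by simp [slopeNum, starProd, pfaffianFour, baseValue]; ring)
    have e03 := aux 0 3 1 2 n03 h03 (by rw [Fin.prod_univ_four]; ring)
      (by simp [starProd, hNdef, edgeProd]; ring)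
      (by simp [slopeNum, hddef, pfaffianFour, baseValue]; ring)
      (by simp [slopeNum, starProd, pfaffianFour, baseValue]; ring)
    have e12 := aux 1 2 0 3 n12 h12 (by rw [Fin.prod_univ_four]; ring)
      (by simp [starProd, hNdef, edgeProd]; ring)
      (by simp [slopeNum, hddef, pfaffianFour, baseValue]; ring)
      (by simp [slopeNum, starProd, pfaffianFour, baseValue]; ring)
    have e13 := aux 1 3 0 2 n13 h13 (by rw [Fin.prod_univ_four]; ring)
      (by simp [starProd, hNdef, edgeProd]; ring)
      (by simp [slopeNum, hddef, pfaffianFour, baseValue]; ring)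
      (by simp [slopeNum, starProd, pfaffianFour, baseValue]; ring)
    have e23 := aux 2 3 0 1 n23 h23 (by rw [Fin.prod_univ_four]; ring)
      (by simp [starProd, hNdef, edgeProd]; ring) (by simp [slopeNum, hddef]; ring)
      (by simp [slopeNum, starProd]; ring)
    intro i j hij
    have hcases : ∀ i j : Fin 4, i < j → i = 0 ∧ j = 1 ∨ i = 0 ∧ j = 2 ∨ i = 0 ∧ j = 3 ∨
        i = 1 ∧ j = 2 ∨ i = 1 ∧ j = 3 ∨ i = 2 ∧ j = 3 := by decide
    rcases hcases i j hij with ⟨rfl, rfl⟩ | ⟨rfl, rfl⟩ | ⟨rfl, rfl⟩ | ⟨rfl, rfl⟩ | ⟨rfl, rfl⟩ |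
      ⟨rfl, rfl⟩
    exacts [e01, e02, e03, e12, e13, e23]
  refine ⟨γ 0 ^ 2 - 1 / S 0 - B * S 0, B, S, γ, div_ne_zero (mul_ne_zero hP0 hd) hN, ?_, hS,
    fun i => div_ne_zero (mul_ne_zero hP0 (hG i)) (mul_ne_zero two_ne_zero hN), fun i => ?_,
    fun i j hij => ⟨?_, (hedge i j hij).2.2.1⟩, ?_⟩
  · -- Here `A = P ^ 2 * curveNum n / (4 * N ^ 2)`.
    have hA : γ 0 ^ 2 - 1 / S 0 - B * S 0 = P ^ 2 * curveNum n / (4 * N ^ 2) := by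
      have hN0 : N = starProd n 0 * (n 1 2 * n 1 3 * n 2 3) := by
        simp [hNdef, edgeProd, starProd]; ring
      have hinv : 1 / S 0 = P ^ 2 * (baseValue n 1 * baseValue n 2 * baseValue n 3) *
          (n 1 2 * n 1 3 * n 2 3) / N ^ 2 := by
        rw [Fin.prod_univ_four] at hP
        rw [div_eq_div_iff (hS 0) (pow_ne_zero 2 hN)]
        simp only [S]
        field_simp
        linear_combination (-N) * hP + P ^ 3 * (baseValue n 0 * baseValue n 1 * baseValue n 2 *
          baseValue n 3) * hN0
      rw [hinv]
      simp only [γ, B, S, curveNum, ← hddef]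
      field_simp
      ring
    rw [hA]
    intro h
    simp only [B] at h
    field_simp at h
    apply hdisc
    apply mul_left_cancel₀ (pow_ne_zero 2 hN)
    linear_combination (∏ i, baseValue n i) * h - curveNum n ^ 2 * hP
  · rcases eq_or_ne i 0 with rfl | hi
    · have := hS 0
      field_simp
      ring
    · obtain ⟨hne, -, h1, h2⟩ := hedge 0 i (Fin.pos_of_ne_zero hi)
      have := hS 0
      field_simp
      apply mul_left_cancel₀ hne
      linear_combination (γ i + γ 0) * n 0 i * h1 + n 0 i * (1 - B * S 0 * S i) * h2
  · intro h
    obtain ⟨-, hne, h1, -⟩ := hedge i j hij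
    rw [h, mul_zero] at h1
    have h2 : P * (slopeNum n j - slopeNum n i) = 0 := by
      have := (mul_eq_zero.1 h1).resolve_left (mul_ne_zero (hS i) (hS j))
      simp only [γ] at this
      field_simp at this
      linear_combination this
    exact hne ((mul_eq_zero.1 h2).resolve_left hP0)
  · have hbase : ∀ i j k l, ∏ a, baseValue n a = baseValue n i * baseValue n j * baseValue n k *
        baseValue n l → starProd n i * starProd n j * starProd n k = N * (n i j * n i k * n j k) →
        S i * S j * S k * baseValue n l = n i j * n i k * n j k := by
      intro i j k l h1 h2
      rw [h1] at hP
      simp only [S]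
      field_simp
      linear_combination starProd n i * starProd n j * starProd n k * hP + N ^ 2 * h2
    have b0 := hbase 1 2 3 0 (by rw [Fin.prod_univ_four]; ring)
      (by simp [starProd, hNdef, edgeProd]; ring)
    have b1 := hbase 0 2 3 1 (by rw [Fin.prod_univ_four]; ring)
      (by simp [starProd, hNdef, edgeProd]; ring)
    have b2 := hbase 0 1 3 2 (by rw [Fin.prod_univ_four]; ring)
      (by simp [starProd, hNdef, edgeProd]; ring)
    have b3 := hbase 0 1 2 3 (by rw [Fin.prod_univ_four])
      (by simp [starProd, hNdef, edgeProd]; ring)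
    intro i j k hij hjk
    have hcases : ∀ i j k : Fin 4, i < j → j < k → i = 1 ∧ j = 2 ∧ k = 3 ∨
        i = 0 ∧ j = 2 ∧ k = 3 ∨ i = 0 ∧ j = 1 ∧ k = 3 ∨ i = 0 ∧ j = 1 ∧ k = 2 := by decide
    rcases hcases i j k hij hjk with ⟨rfl, rfl, rfl⟩ | ⟨rfl, rfl, rfl⟩ | ⟨rfl, rfl, rfl⟩ |
      ⟨rfl, rfl, rfl⟩
    exacts [b0, b1, b2, b3]

end Algebra

/-! ### Points on the Jacobi curve -/

/-- The algebraic solution, transported to `sn` by rescaling the curve `y² = 1 + A x² + B x⁴` to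
Legendre form. -/
theorem exists_jacobiSn_points {n : Fin 4 → Fin 4 → ℂ} (hn : genericityPoly n ≠ 0) :
    ∃ (κ : ℂ) (x : Fin 4 → ℂ) (c : ℂ), κ ≠ 0 ∧ κ ^ 2 ≠ 1 ∧ c ≠ 0 ∧
      (∀ i, AnalyticAt ℂ (jacobiSn κ) (x i)) ∧
      (∀ i j, i < j → AnalyticAt ℂ (jacobiSn κ) (x i - x j) ∧
        c * (jacobiSn κ (x i - x j) * jacobiSn κ (x i) * jacobiSn κ (x j)) = n i j) ∧
      ∀ i j k, i < j → j < k → c * (jacobiSn κ (x i - x j) * jacobiSn κ (x i - x k) *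
        jacobiSn κ (x j - x k)) = n i j + n j k - n i k := by
  obtain ⟨A, B, S, γ, hB, hAB, hS, hγ, hcurve, hpair, htriple⟩ := exists_curve_and_points hn
  -- `1 + A X + B X² = (1 - p X) (1 - κ² p X)` with `p = μ²`; then `κ² p² = B`.
  obtain ⟨z, hz⟩ := IsAlgClosed.exists_pow_nat_eq (A ^ 2 - 4 * B) (n := 2) two_pos
  obtain ⟨μ, hμ⟩ := IsAlgClosed.exists_pow_nat_eq ((-A + z) / 2) (n := 2) two_pos
  obtain ⟨ν, hν⟩ := IsAlgClosed.exists_pow_nat_eq ((-A - z) / 2) (n := 2) two_pos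
  have hprod : μ ^ 2 * ν ^ 2 = B := by
    rw [hμ, hν]; linear_combination -hz / 4
  have hsum : μ ^ 2 + ν ^ 2 = -A := by
    rw [hμ, hν]; ring
  have hμ0 : μ ≠ 0 := by rintro rfl; exact hB (by simpa using hprod.symm)
  have hν0 : ν ≠ 0 := by rintro rfl; exact hB (by simpa using hprod.symm)
  have hne : ν ^ 2 ≠ μ ^ 2 := by
    intro h
    apply hAB
    rw [h] at hprod hsum
    linear_combination (A - μ ^ 2 * 2) * hsum + 4 * hprod
  obtain ⟨κ, hκdef⟩ : ∃ κ, κ = ν / μ := ⟨_, rfl⟩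
  have hκ : κ ^ 2 * μ ^ 2 = ν ^ 2 := by rw [hκdef]; field_simp
  have hpt : ∀ i, ∃ u, AnalyticAt ℂ (jacobiSn κ) u ∧ jacobiSn κ u ^ 2 = μ ^ 2 * S i ∧
      deriv (jacobiSn κ) u = γ i / μ * jacobiSn κ u := by
    intro i
    obtain ⟨τ, hτ⟩ := IsAlgClosed.exists_pow_nat_eq (S i) (n := 2) two_pos
    have hτ0 : τ ≠ 0 := by rintro rfl; exact hS i (by simpa using hτ.symm)
    obtain ⟨u, h1, h2, h3⟩ := exists_jacobiSn_sq_eq (κ := κ) (σ := μ * τ)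
      (div_ne_zero (hγ i) hμ0) (by
        have := hcurve i
        rw [← hτ] at this
        field_simp
        linear_combination this - τ ^ 4 * (hprod + μ ^ 2 * hκ) + τ ^ 2 * (hsum + hκ))
      (mul_ne_zero hμ0 hτ0)
    exact ⟨u, h1, by rw [h2, mul_pow, hτ], h3⟩
  choose x hx hsq hder using hpt
  have hx0 : ∀ i, jacobiSn κ (x i) ≠ 0 := fun i h => by
    have := hsq i
    rw [h] at this
    exact mul_ne_zero (pow_ne_zero 2 hμ0) (hS i) (by simpa using this.symm)
  have hden : ∀ i j, 1 - κ ^ 2 * jacobiSn κ (x i) ^ 2 * jacobiSn κ (x j) ^ 2 = 1 - B * S i * S j := by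
    intro i j
    rw [hsq, hsq]
    linear_combination -(μ ^ 2 * S i * S j) * hκ - S i * S j * hprod
  have hedge : ∀ i j, i < j → AnalyticAt ℂ (jacobiSn κ) (x i - x j) ∧
      (μ ^ 3)⁻¹ * (jacobiSn κ (x i - x j) * jacobiSn κ (x i) * jacobiSn κ (x j)) = n i j := by
    intro i j hij
    obtain ⟨h1, h2⟩ := hpair i j hij
    have hD := h1
    rw [← hden] at hD
    obtain ⟨ha, hadd⟩ := jacobiSn_sub (hx i) (hx j) hD
    refine ⟨ha, mul_right_cancel₀ h1 ?_⟩
    rw [hden, hder, hder] at hadd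
    rw [← h2]
    calc (μ ^ 3)⁻¹ * (jacobiSn κ (x i - x j) * jacobiSn κ (x i) * jacobiSn κ (x j)) *
          (1 - B * S i * S j)
        = (μ ^ 3)⁻¹ * (jacobiSn κ (x i) * jacobiSn κ (x j)) *
          (jacobiSn κ (x i - x j) * (1 - B * S i * S j)) := by ring
      _ = (μ ^ 4)⁻¹ * (jacobiSn κ (x i) ^ 2 * jacobiSn κ (x j) ^ 2) * (γ j - γ i) := by
          rw [hadd]; field_simp
      _ = S i * S j * (γ j - γ i) := by rw [hsq, hsq]; field_simp
  refine ⟨κ, x, (μ ^ 3)⁻¹, hκdef ▸ div_ne_zero hν0 hμ0, ?_, inv_ne_zero (pow_ne_zero 3 hμ0), hx, hedge, ?_⟩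
  · intro h
    rw [h, one_mul] at hκ
    exact hne hκ.symm
  · intro i j k hij hjk
    have e1 := (hedge i j hij).2
    have e2 := (hedge i k (hij.trans hjk)).2
    have e3 := (hedge j k hjk).2
    have ht := htriple i j k hij hjk
    apply mul_left_cancel₀ (mul_ne_zero (mul_ne_zero (hS i) (hS j)) (hS k))
    rw [ht, ← e1, ← e2, ← e3]
    have hS' : ∀ i, S i = jacobiSn κ (x i) ^ 2 / μ ^ 2 := fun i => by
      rw [hsq]; field_simp
    rw [hS', hS', hS']
    field_simp

/-! ### Cochains of low degree -/

section Coboundary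

variable {V : Type*} [LinearOrder V] {K : AbstractSimplicialComplex V}

theorem simplicialCoboundary_one_apply (ν : SimplicialCochain K 1) (s : OrderedSimplex K 2) :
    simplicialCoboundary K 1 ν s = ν (s.face 0) - ν (s.face 1) + ν (s.face 2) := by
  change ∑ i : Fin 3, (-1 : ℂ) ^ (i : ℕ) * ν (s.face i) = _
  rw [Fin.sum_univ_three]
  simp
  ring

theorem simplicialCoboundary_two_apply (ω : SimplicialCochain K 2) (s : OrderedSimplex K 3) :
    simplicialCoboundary K 2 ω s =
      ω (s.face 0) - ω (s.face 1) + ω (s.face 2) - ω (s.face 3) := by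
  change ∑ i : Fin 4, (-1 : ℂ) ^ (i : ℕ) * ω (s.face i) = _
  rw [Fin.sum_univ_four]
  simp
  ring

end Coboundary

/-! ### Cochains of the 4-simplex -/

/-- The triangle `i j k` of the 4-simplex. -/
def fourTriangle (i j k : Fin 5) (hij : i < j) (hjk : j < k) : OrderedSimplex fourSimplex 2 :=
  ⟨OrderEmbedding.ofStrictMono ![i, j, k] (by
    rw [Fin.strictMono_iff_lt_succ]
    intro a
    fin_cases a
    exacts [hij, hjk]), by simp [fourSimplex]⟩

/-- The tetrahedron `i j k l` of the 4-simplex. -/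
def fourTetrahedron (i j k l : Fin 5) (hij : i < j) (hjk : j < k) (hkl : k < l) :
    OrderedSimplex fourSimplex 3 :=
  ⟨OrderEmbedding.ofStrictMono ![i, j, k, l] (by
    rw [Fin.strictMono_iff_lt_succ]
    intro a
    fin_cases a
    exacts [hij, hjk, hkl]), by simp [fourSimplex]⟩

theorem eq_fourTriangle (s : OrderedSimplex fourSimplex 2) :
    s = fourTriangle (s.1 0) (s.1 1) (s.1 2) (s.1.strictMono (by decide))
      (s.1.strictMono (by decide)) := by
  apply Subtype.ext
  apply DFunLike.ext
  intro a
  fin_cases a <;> rfl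

theorem fourTriangle_add_of_mem_ker {w : SimplicialCochain fourSimplex 2}
    (hw : w ∈ LinearMap.ker (simplicialCoboundary fourSimplex 2)) {i j k l : Fin 5}
    (hij : i < j) (hjk : j < k) (hkl : k < l) :
    w (fourTriangle i j k hij hjk) = w (fourTriangle i j l hij (hjk.trans hkl)) +
      w (fourTriangle j k l hjk hkl) - w (fourTriangle i k l (hij.trans hjk) hkl) := by
  have h := congrFun (LinearMap.mem_ker.1 hw) (fourTetrahedron i j k l hij hjk hkl)
  have h0 : (fourTetrahedron i j k l hij hjk hkl).face 0 = fourTriangle j k l hjk hkl := by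
    apply Subtype.ext; apply DFunLike.ext; intro a; fin_cases a <;> rfl
  have h1 : (fourTetrahedron i j k l hij hjk hkl).face 1 =
      fourTriangle i k l (hij.trans hjk) hkl := by
    apply Subtype.ext; apply DFunLike.ext; intro a; fin_cases a <;> rfl
  have h2 : (fourTetrahedron i j k l hij hjk hkl).face 2 =
      fourTriangle i j l hij (hjk.trans hkl) := by
    apply Subtype.ext; apply DFunLike.ext; intro a; fin_cases a <;> rfl
  have h3 : (fourTetrahedron i j k l hij hjk hkl).face 3 = fourTriangle i j k hij hjk := by
    apply Subtype.ext; apply DFunLike.ext; intro a; fin_cases a <;> rfl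
  rw [simplicialCoboundary_two_apply, h0, h1, h2, h3, Pi.zero_apply] at h
  linear_combination -h

/-- The values of a 2-cochain on the triangles `i j 4`, which determine it if it is a cocycle; the
junk value `0` is used when `i < j` fails. -/
def linkValue {R : Type*} [Zero R] (a : OrderedSimplex fourSimplex 2 → R) (i j : Fin 4) : R :=
  if h : i < j then a (fourTriangle i.castSucc j.castSucc (Fin.last 4)
    (Fin.castSucc_lt_castSucc_iff.2 h) (Fin.castSucc_lt_last j)) else 0

theorem eval_genericityPoly_linkValue_X (w : OrderedSimplex fourSimplex 2 → ℂ) :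
    MvPolynomial.eval w (genericityPoly (linkValue MvPolynomial.X)) =
      genericityPoly (linkValue w) := by
  rw [map_genericityPoly]
  congr 1
  funext i j
  unfold linkValue
  split_ifs <;> simp

theorem exists_mem_ker_genericityPoly_ne_zero :
    ∃ w ∈ LinearMap.ker (simplicialCoboundary fourSimplex 2),
      genericityPoly (linkValue w) ≠ 0 := by
  -- The coboundary of a 1-cochain vanishing on the edges at the last vertex.
  let M : Matrix (Fin 5) (Fin 5) ℂ :=
    !![0, 1, 1, 2, 0; 0, 0, 2, 2, 0; 0, 0, 0, 3, 0; 0, 0, 0, 0, 0; 0, 0, 0, 0, 0]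
  refine ⟨fun s => M (s.1 0) (s.1 1) + M (s.1 1) (s.1 2) - M (s.1 0) (s.1 2), ?_, ?_⟩
  · rw [LinearMap.mem_ker]
    funext t
    rw [simplicialCoboundary_two_apply]
    have h : ∀ (i : Fin 4) (a : Fin 3), (t.face i).1 a = t.1 (i.succAbove a) := fun _ _ => rfl
    have e0 : ∀ a, (0 : Fin 4).succAbove a = ![1, 2, 3] a := by decide
    have e1 : ∀ a, (1 : Fin 4).succAbove a = ![0, 2, 3] a := by decide
    have e2 : ∀ a, (2 : Fin 4).succAbove a = ![0, 1, 3] a := by decide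
    have e3 : ∀ a, (3 : Fin 4).succAbove a = ![0, 1, 2] a := by decide
    simp only [h, e0, e1, e2, e3, Matrix.cons_val, Pi.zero_apply]
    ring
  · have key : ∀ i j : Fin 4, linkValue (fun s : OrderedSimplex fourSimplex 2 =>
        M (s.1 0) (s.1 1) + M (s.1 1) (s.1 2) - M (s.1 0) (s.1 2)) i j =
        if i < j then M i.castSucc j.castSucc else 0 := by
      intro i j
      unfold linkValue
      split_ifs with hij
      · have h4 : ∀ a, M a 4 = 0 := by
          intro a
          fin_cases a <;> rfl
        change M i.castSucc j.castSucc + M j.castSucc 4 - M i.castSucc 4 = _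
        rw [h4, h4]
        ring
      · rfl
    generalize linkValue (fun s : OrderedSimplex fourSimplex 2 =>
        M (s.1 0) (s.1 1) + M (s.1 1) (s.1 2) - M (s.1 0) (s.1 2)) = n at key ⊢
    have k01 : n 0 1 = 1 := by simp [key, M]
    have k02 : n 0 2 = 1 := by simp [key, M]
    have k03 : n 0 3 = 2 := by simp [key, M]
    have k12 : n 1 2 = 2 := by simp [key, M]
    have k13 : n 1 3 = 2 := by simp [key, M]
    have k23 : n 2 3 = 3 := by simp [key, M]
    simp only [genericityPoly, curveNum, slopeNum, pfaffianFour, edgeProd, starProd, baseValue,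
      Fin.prod_univ_four, Matrix.cons_val, k01, k02, k03, k12, k13, k23]
    norm_num

/-! ### Generic cocycles on the 4-simplex -/

theorem mainTheorem7 :
    (∀ (V : Type*) [LinearOrder V] (K : AbstractSimplicialComplex V) (κ : ℂ) (x : V → ℂ),
      (∀ i j : V, i < j → {i, j} ∈ K.faces → AnalyticAt ℂ (jacobiSn κ) (x i - x j)) →
      ∃ ν : SimplicialCochain K 1, ellipticCochain K κ x = simplicialCoboundary K 1 ν) ∧
    HoldsGenerically (LinearMap.ker (simplicialCoboundary fourSimplex 2)) (fun ω =>
      ∃ (κ : ℂ) (x : Fin 5 → ℂ) (c : ℂ), κ ≠ 0 ∧ κ ^ 2 ≠ 1 ∧ c ≠ 0 ∧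
        (∀ i j : Fin 5, AnalyticAt ℂ (jacobiSn κ) (x i - x j)) ∧
        ω = c • ellipticCochain fourSimplex κ x) := by
  constructor
  · intro V _ K κ x hx
    obtain ⟨h, hh⟩ := exists_add_formula κ
    refine ⟨fun e => h (x (e.1 0) - x (e.1 1)), ?_⟩
    funext s
    have hreg : ∀ a b : Fin 3, a < b →
        AnalyticAt ℂ (jacobiSn κ) (x (s.1 a) - x (s.1 b)) := by
      intro a b hab
      refine hx _ _ (s.1.strictMono hab) ((K.isRelLowerSet_faces s.2).2 ?_ (by simp))
      intro v hv
      simp only [Finset.mem_insert, Finset.mem_singleton] at hv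
      rcases hv with rfl | rfl <;> simp
    have h01 := hreg 0 1 (by decide)
    have h02 := hreg 0 2 (by decide)
    have h12 := hreg 1 2 (by decide)
    have hsum : x (s.1 0) - x (s.1 1) + (x (s.1 1) - x (s.1 2)) = x (s.1 0) - x (s.1 2) := by ring
    have key := hh _ _ h01 h12 (by rwa [hsum])
    rw [hsum] at key
    have hf : ∀ (i : Fin 3) (a : Fin 2), (s.face i).1 a = s.1 (i.succAbove a) := fun _ _ => rfl
    have e0 : ∀ a, (0 : Fin 3).succAbove a = ![1, 2] a := by decide
    have e1 : ∀ a, (1 : Fin 3).succAbove a = ![0, 2] a := by decide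
    have e2 : ∀ a, (2 : Fin 3).succAbove a = ![0, 1] a := by decide
    rw [simplicialCoboundary_one_apply]
    simp only [hf, e0, e1, e2, ellipticCochain, Matrix.cons_val]
    linear_combination -key
  · obtain ⟨w₀, hw₀, hne₀⟩ := exists_mem_ker_genericityPoly_ne_zero
    refine ⟨genericityPoly (linkValue MvPolynomial.X),
      ⟨w₀, hw₀, by rwa [eval_genericityPoly_linkValue_X]⟩, fun w hw hne => ?_⟩
    rw [eval_genericityPoly_linkValue_X] at hne
    obtain ⟨κ, x, c, hκ0, hκ1, hc, hx, hpair, htriple⟩ := exists_jacobiSn_points hne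
    -- The fifth point is placed at the origin.
    obtain ⟨y, hy, hy4⟩ : ∃ y : Fin 5 → ℂ, (∀ i : Fin 4, y i.castSucc = x i) ∧ y (Fin.last 4) = 0 :=
      ⟨Fin.snoc x 0, fun i => Fin.snoc_castSucc (α := fun _ => ℂ) _ _ i,
        Fin.snoc_last (α := fun _ => ℂ) _ _⟩
    have hlt : ∀ i j : Fin 5, i < j → AnalyticAt ℂ (jacobiSn κ) (y i - y j) := by
      intro i j hij
      obtain ⟨i, rfl⟩ := Fin.exists_castSucc_eq.2 (hij.trans_le (Fin.le_last j)).ne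
      induction j using Fin.lastCases with
      | last => rw [hy, hy4, sub_zero]; exact hx i
      | cast j => rw [hy, hy]; exact (hpair i j (Fin.castSucc_lt_castSucc_iff.1 hij)).1
    have hval : ∀ (i j k : Fin 5) (hij : i < j) (hjk : j < k), w (fourTriangle i j k hij hjk) =
        c * (jacobiSn κ (y i - y j) * jacobiSn κ (y i - y k) * jacobiSn κ (y j - y k)) := by
      intro i j k hij hjk
      obtain ⟨j, rfl⟩ := Fin.exists_castSucc_eq.2 (hjk.trans_le (Fin.le_last k)).ne
      obtain ⟨i, rfl⟩ := Fin.exists_castSucc_eq.2 (hij.trans (Fin.castSucc_lt_last j)).ne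
      have hij' := Fin.castSucc_lt_castSucc_iff.1 hij
      have hlink : ∀ a b (h : a < b), w (fourTriangle a.castSucc b.castSucc (Fin.last 4)
          (Fin.castSucc_lt_castSucc_iff.2 h) (Fin.castSucc_lt_last b)) = linkValue w a b :=
        fun a b h => by simp [linkValue, h]
      induction k using Fin.lastCases with
      | last =>
        rw [hlink i j hij', hy, hy, hy4, sub_zero, sub_zero]
        exact (hpair i j hij').2.symm
      | cast k =>
        have hjk' := Fin.castSucc_lt_castSucc_iff.1 hjk
        rw [fourTriangle_add_of_mem_ker hw hij hjk (Fin.castSucc_lt_last k), hlink i j hij',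
          hlink j k hjk', hlink i k (hij'.trans hjk'), hy, hy, hy]
        exact (htriple i j k hij' hjk').symm
    refine ⟨κ, y, c, hκ0, hκ1, hc, fun i j => ?_, ?_⟩
    · rcases lt_trichotomy i j with h | rfl | h
      · exact hlt i j h
      · rw [sub_self]; exact analyticAt_jacobiSn_zero κ
      · rw [← neg_sub]; exact analyticAt_jacobiSn_neg (hlt j i h)
    · funext s
      conv_lhs => rw [eq_fourTriangle s]
      exact hval _ _ _ _ _
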